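/- Let $\mathsf{St}_{d,r}=\{X\in\mathbb R^{d\times r}: X^{\mathsf T}X=I_r\}$ with tangent spaces $\mathbf T_X=\{Z: X^{\mathsf T}Z+Z^{\mathsf T}X=0\}$, let $\|\cdot\|$ be the Frobenius norm, $n\ge 1$, and $f=\frac1n\sum_{i=1}^n f_i$ with $f_i:\mathbb R^{d\times r}\to\mathbb R$. Assume that each $f_i$ is differentiable at the points of $\mathsf{St}_{d,r}$ with Euclidean gradient $\nabla f_i$ that is $L$-Lipschitz on $\mathsf{St}_{d,r}$, that $f$ is differentiable at the points of the convex hull of $\mathsf{St}_{d,r}$ with $\nabla f$ $L$-Lipschitz there ($L>0$), and let $C>0$ satisfy $\|\nabla f\|\le C$ on $\mathsf{St}_{d,r}$. For $\rho\ge 0$ put $\mathbf D_\rho(X,Y)=(I-XX^{\mathsf T})Y+4\rho X\,\mathrm{skew}(X^{\mathsf T}Y)$ with $\mathrm{skew}(A)=(A-A^{\mathsf T})/2$, $\mathrm{grad} f(X)=\mathbf D_\rho(X,\nabla f(X))$ and $\nu=\min\{1,1/(4\rho)\}$ ($\nu=1$ if $\rho=0$). Let $\mathcal R$ be a retraction on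 $\mathsf{St}_{d,r}$ (for each $X\in\mathsf{St}_{d,r}$, a smooth map $\mathcal R(X,\cdot):\mathbf T_X\to\mathsf{St}_{d,r}$ with $\mathcal R(X,0)=X$ and $\frac{d}{dt}\mathcal R(X,tE)|_{t=0}=E$), and let $L_1\ge1$, $L_2>0$ be such that $\|\mathcal R(X,tE)-X\|\le L_1t\|E\|$ and $\|\mathcal R(X,tE)-X-tE\|\le L_2t^2\|E\|^2$ for all $X\in\mathsf{St}_{d,r}$, $E\in\mathbf T_X$, $t\ge0$. Put $\hat L=2L_2C+L_1^2L$ and $\tilde L=L_1^2+4L_2\sqrt r$. Let $0\le\mu\le 2/3$, $\kappa>0$, let $c\in(0,1)$ satisfy $\frac{\hat L}{\sqrt{\tilde L}L}\exp(c^2+2c)\,c\le1$, and set $$K=\big\lceil(\kappa n)^{\frac1{3(1-\mu)}}\big\rceil,\quad b=\lceil K^{2-3\mu}\rceil,\quad \beta=\frac{\sqrt{\tilde L}L}{\nu}K^{\mu-1},\quad \tau=\frac{c\nu}{\sqrt{\tilde L}L}K^{-\mu},$$ $$\Delta_k=\tau\Big(\nu-\frac{\hat L\tau}2\Big[1+\Big(1+\frac2{\tilde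 L\beta\tau}\Big)\frac{\tilde LL^2\tau^2}{\nu^2b}\,\Gamma\Big(2\beta\tau+\frac{\tilde LL^2\tau^2}{\nu^2b},K-k\Big)\Big]\Big),\quad \Gamma(z,i)=\frac{(1+z)^{i-1}-1}{z},\quad 0\le k<K.$$ Let $\bar X\in\mathsf{St}_{d,r}$ be a stationary point, $\mathrm{grad} f(\bar X)=0$, and let $\delta,\alpha>0$ be such that $|f(X)-f(\bar X)|^{1/2}\le\alpha\|\mathrm{grad} f(X)\|$ for all $X\in\mathsf{St}_{d,r}$ with $\|X-\bar X\|\le\delta$. Consider the following variant of S-SVRG, run for infinitely many epochs $s=0,1,2,\dots$ from a given $X^{0,0}\in\mathsf{St}_{d,r}$. In epoch $s$, for $k=0,\dots,K-1$, draw a mini-batch $\xi_{s,k}$ of $b$ indices from $\{1,\dots,n\}$, uniformly with replacement, and set $$\mathcal G^{s,k}=\nabla f(X^{s,0})+\frac1b\sum_{i\in\xi_{s,k}}\big(\nabla f_i(X^{s,k})-\nabla f_i(X^{s,0})\big),\qquad X^{s,k+1}=\mathcal R\big(X^{s,k},-\tau\,\mathbf D_\rho(X^{s,k},\mathcal G^{s,k})\big);$$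 then set $X_r^s=X^{s,k}$ with probability $p_k$, where $p_k=\Delta_k/(\alpha^2+\sum_{j<K}\Delta_j)$ for $k<K$ and $p_K=\alpha^2/(\alpha^2+\sum_{j<K}\Delta_j)$, and restart from $X^{s+1,0}=X_r^s$. All random choices are mutually independent. Suppose that almost surely all iterates $X^{s,k}$ ($s\ge0$, $0\le k\le K$) satisfy $\|X^{s,k}-\bar X\|\le\delta$. With $$q=\frac{2\sqrt{\tilde L}L\alpha^2}{2\sqrt{\tilde L}L\alpha^2+c\nu^2(\kappa n)^{1/3}},$$ for every $s\ge0$, almost surely, $$\mathbb E\big[f(X_r^s)-f(\bar X)\,\big|\,\text{random choices of the epochs before } s\big]\le q\,\big(f(X^{s,0})-f(\bar X)\big)$$ (where $X^{s,0}=X_r^{s-1}$ for $s\ge1$), and consequently $\mathbb E[f(X_r^s)-f(\bar X)]\le q^{s+1}(f(X^{0,0})-f(\bar X))$. -/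

import Mathlib

open MeasureTheory ProbabilityTheory
open scoped Matrix

/-! Matrices carry the Frobenius norm throughout. -/
attribute [local instance] Matrix.frobeniusNormedAddCommGroup Matrix.frobeniusNormedSpace

noncomputable section

namespace SSVRG

/-- The ambient space `ℝ^{d × r}`. -/
abbrev Mat (d r : ℕ) : Type := Matrix (Fin d) (Fin r) ℝ

/-- The Stiefel manifold `{X | Xᵀ X = I_r}`. -/
def Stiefel (d r : ℕ) : Set (Mat d r) := {X | Xᵀ * X = 1}

/-- The tangent space of the Stiefel manifold at `X`. -/
def TangentAt {d r : ℕ} (X : Mat d r) : Set (Mat d r) := {Z | Xᵀ * Z + Zᵀ * X = 0}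

/-- The Euclidean gradient: the matrix of partial derivatives of `f` at `X`. -/
def euclGrad {d r : ℕ} (f : Mat d r → ℝ) (X : Mat d r) : Mat d r :=
  Matrix.of fun i j => fderiv ℝ f X (Matrix.single i j 1)

/-- The skew-symmetric part of a square matrix. -/
def skewPart {r : ℕ} (A : Matrix (Fin r) (Fin r) ℝ) : Matrix (Fin r) (Fin r) ℝ :=
  (1 / 2 : ℝ) • (A - Aᵀ)

/-- The operator `D_ρ(X, Y) = (I - X Xᵀ) Y + 4 ρ X skew(Xᵀ Y)`. -/
def dirOp {d r : ℕ} (ρ : ℝ) (X Y : Mat d r) : Mat d r :=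
  (1 - X * Xᵀ) * Y + (4 * ρ) • (X * skewPart (Xᵀ * Y))

/-- The Riemannian gradient `D_ρ(X, ∇f(X))`. For `ρ > 0` it represents the differential of `f` on
the tangent space with respect to `⟨E₁, (I - (1 - 1/(4ρ)) X Xᵀ) E₂⟩`; for `ρ = 0` it is the
gradient on the Grassmann manifold, in its quotient representation. -/
def riemGrad {d r : ℕ} (ρ : ℝ) (f : Mat d r → ℝ) (X : Mat d r) : Mat d r :=
  dirOp ρ X (euclGrad f X)

/-- The objective `f = (1/n) ∑ᵢ fᵢ`. -/
def objective {d r n : ℕ} (f : Fin n → Mat d r → ℝ) (X : Mat d r) : ℝ :=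
  (1 / (n : ℝ)) * ∑ i, f i X

/-- A retraction on the Stiefel manifold, `R X E` being the point reached from `X` along the
tangent vector `E`. -/
structure IsRetraction {d r : ℕ} (R : Mat d r → Mat d r → Mat d r) : Prop where
  maps : ∀ X ∈ Stiefel d r, ∀ E ∈ TangentAt X, R X E ∈ Stiefel d r
  smooth : ∀ X ∈ Stiefel d r, ContDiffOn ℝ (⊤ : ℕ∞) (R X) (TangentAt X)
  zero : ∀ X ∈ Stiefel d r, R X 0 = X
  deriv : ∀ X ∈ Stiefel d r, ∀ E ∈ TangentAt X, HasDerivAt (fun t : ℝ => R X (t • E)) E 0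

/-- `L₁` and `L₂` are first- and second-order constants of the retraction `R`. -/
structure RetractionConstants {d r : ℕ} (R : Mat d r → Mat d r → Mat d r) (L₁ L₂ : ℝ) : Prop where
  one_le : 1 ≤ L₁
  pos : 0 < L₂
  first : ∀ X ∈ Stiefel d r, ∀ E ∈ TangentAt X, ∀ t : ℝ, 0 ≤ t →
    ‖R X (t • E) - X‖ ≤ L₁ * t * ‖E‖
  second : ∀ X ∈ Stiefel d r, ∀ E ∈ TangentAt X, ∀ t : ℝ, 0 ≤ t →
    ‖R X (t • E) - X - t • E‖ ≤ L₂ * t ^ 2 * ‖E‖ ^ 2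

/-! ### The algorithm, for a given outcome of all random choices -/

section Algorithm

variable {d r n b K : ℕ}

/-- The variance-reduced stochastic Euclidean gradient at `X`, with reference point `X₀` and
mini-batch `B` (a list of `b` indices, repetitions allowed). -/
def svrgGrad (f : Fin n → Mat d r → ℝ) (X₀ : Mat d r) (B : Fin b → Fin n) (X : Mat d r) :
    Mat d r :=
  euclGrad (objective f) X₀ +
    (1 / (b : ℝ)) • ∑ j, (euclGrad (f (B j)) X - euclGrad (f (B j)) X₀)

/-- The inner iterates `X^{s,k}` of one epoch started at `X₀`, with mini-batches `B 0, B 1, …`. -/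
def innerIter (R : Mat d r → Mat d r → Mat d r) (ρ τ : ℝ) (f : Fin n → Mat d r → ℝ)
    (X₀ : Mat d r) (B : ℕ → Fin b → Fin n) : ℕ → Mat d r
  | 0 => X₀
  | k + 1 =>
    R (innerIter R ρ τ f X₀ B k)
      (-(τ • dirOp ρ (innerIter R ρ τ f X₀ B k) (svrgGrad f X₀ (B k) (innerIter R ρ τ f X₀ B k))))

/-- The starting points `X^{s,0}` of the epochs: `X^{0,0}` is given and `X^{s+1,0} = X_r^s` is the
inner iterate of epoch `s` with the randomly selected index `idx s ∈ {0, …, K}`. -/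
def epochStart (R : Mat d r → Mat d r → Mat d r) (ρ τ : ℝ) (f : Fin n → Mat d r → ℝ)
    (X₀₀ : Mat d r) (B : ℕ → ℕ → Fin b → Fin n) (idx : ℕ → Fin (K + 1)) : ℕ → Mat d r
  | 0 => X₀₀
  | s + 1 => innerIter R ρ τ f (epochStart R ρ τ f X₀₀ B idx s) (B s) (idx s)

/-- The iterate `X^{s,k}`. -/
def iter (R : Mat d r → Mat d r → Mat d r) (ρ τ : ℝ) (f : Fin n → Mat d r → ℝ)
    (X₀₀ : Mat d r) (B : ℕ → ℕ → Fin b → Fin n) (idx : ℕ → Fin (K + 1)) (s k : ℕ) : Mat d r :=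
  innerIter R ρ τ f (epochStart R ρ τ f X₀₀ B idx s) (B s) k

/-- The output `X_r^s` of epoch `s`. -/
def epochOutput (R : Mat d r → Mat d r → Mat d r) (ρ τ : ℝ) (f : Fin n → Mat d r → ℝ)
    (X₀₀ : Mat d r) (B : ℕ → ℕ → Fin b → Fin n) (idx : ℕ → Fin (K + 1)) (s : ℕ) : Mat d r :=
  iter R ρ τ f X₀₀ B idx s (idx s)

end Algorithm

/-! ### Randomness -/

section Randomness

variable {n b K : ℕ} {Ω : Type*}

/-- The random choices of the algorithm: the mini-batches `ξ s k`, `k < K`, are uniform on the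
`b`-tuples of indices, the output index `idx s` has the law `p` on `{0, …, K}`, and all of these
random variables are mutually independent. -/
structure IsSampling [MeasurableSpace Ω] (P : Measure Ω) (p : Fin (K + 1) → ℝ)
    (ξ : ℕ → ℕ → Ω → Fin b → Fin n) (idx : ℕ → Ω → Fin (K + 1)) : Prop where
  measurable_batch : ∀ s, ∀ k < K, Measurable (ξ s k)
  measurable_idx : ∀ s, Measurable (idx s)
  law_batch : ∀ s, ∀ k < K, ∀ u : Fin b → Fin n, P.real {ω | ξ s k ω = u} = 1 / (n : ℝ) ^ b
  law_idx : ∀ s k, P.real {ω | idx s ω = k} = p k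
  indep : iIndep
    (Sum.elim (fun q : ℕ × Fin K => MeasurableSpace.comap (ξ q.1 q.2) inferInstance)
      (fun s : ℕ => MeasurableSpace.comap (idx s) inferInstance)) P

/-- The information available at the start of epoch `s`: the σ-algebra generated by all random
choices of the epochs before `s`. -/
@[reducible] def past (ξ : ℕ → ℕ → Ω → Fin b → Fin n) (idx : ℕ → Ω → Fin (K + 1)) (s : ℕ) :
    MeasurableSpace Ω :=
  ⨆ (s' : ℕ) (_ : s' < s),
    (⨆ k : Fin K, MeasurableSpace.comap (ξ s' k) inferInstance) ⊔
      MeasurableSpace.comap (idx s') inferInstance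

end Randomness

/-! ### Constants and parameters -/

/-- `ν = min {1, 1/(4ρ)}`, which is `1` for `ρ = 0`. -/
def nu (ρ : ℝ) : ℝ := if ρ = 0 then 1 else min 1 (1 / (4 * ρ))

/-- `L̂ = 2 L₂ C + L₁² L`. -/
def hatL (L L₁ L₂ C : ℝ) : ℝ := 2 * L₂ * C + L₁ ^ 2 * L

/-- `L̃ = L₁² + 4 L₂ √r`. -/
def tildeL (L₁ L₂ : ℝ) (r : ℕ) : ℝ := L₁ ^ 2 + 4 * L₂ * √(r : ℝ)

/-- `Γ(z, i) = ((1 + z)^{i-1} - 1) / z`, used for `i ≥ 1` and `z > 0`. -/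
def Gam (z : ℝ) (i : ℕ) : ℝ := ((1 + z) ^ (i - 1) - 1) / z

/-- The weight `Δ_k`, `0 ≤ k < K`, where `Lh = L̂`, `Lt = L̃`, `v = ν`, and `b` is the batch
size. -/
def Del (Lh Lt L v β τ : ℝ) (b K k : ℕ) : ℝ :=
  τ * (v - Lh * τ / 2 *
    (1 + (1 + 2 / (Lt * β * τ)) * (Lt * L ^ 2 * τ ^ 2 / (v ^ 2 * b)) *
      Gam (2 * β * τ + Lt * L ^ 2 * τ ^ 2 / (v ^ 2 * b)) (K - k)))

/-- The law of the output index: `Δ_k / (α² + ∑ Δ_j)` for `k < K` and `α² / (α² + ∑ Δ_j)` for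
`k = K`. -/
def outputLaw (α : ℝ) (K : ℕ) (Δ : ℕ → ℝ) (k : Fin (K + 1)) : ℝ :=
  (if (k : ℕ) < K then Δ k else α ^ 2) / (α ^ 2 + ∑ j ∈ Finset.range K, Δ j)

/-- The contraction factor `2 √L̃ L α² / (2 √L̃ L α² + c ν² (κ n)^{1/3})`, where `Lt = L̃`
and `v = ν`. -/
def rate (Lt L α c v κ : ℝ) (n : ℕ) : ℝ :=
  2 * √Lt * L * α ^ 2 / (2 * √Lt * L * α ^ 2 + c * v ^ 2 * (κ * n) ^ (1 / 3 : ℝ))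

end SSVRG

end

namespace SSVRG

/-! Fix an event known at the start of an epoch. Over it, let `F k`, `E k`, `G k` be the integrals
of the gap `f(X^{s,k}) - f(X̄)`, of the squared drift from the reference point `X^{s,0}`, and of the
squared gradient norm. The variance-reduced direction is unbiased, with variance at most a multiple
of the squared drift. Hence `F` decreases by a multiple of `G k` up to an error in `E k`, and `E`
obeys a linear recursion driven by `G` (`batchAvg_objective_step_le`, `batchAvg_dist_step_le`).
Adding a multiple of `E k`, with coefficients fixed by a backward recursion vanishing at `K`,
removes the drift and leaves exactly `Δ_k` in front of `G k`: the sum of `Δ_j G_j` is at most `F 0 -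
F K` (`epoch_decrease`). The parameters force `Δ_k ≥ τν/2` (`half_le_Del`), so `S = ∑ Δ_j` is at
least a multiple of `(κn)^{1/3}`.

The output law is built for the Łojasiewicz inequality: `Δ_j F_j ≤ α² Δ_j G_j`, and the weight `α²`
on the last iterate lets the decrease absorb these terms, so the mean gap is at most `α²/(α²+S) · F
0` (`outputLaw_mean_le`).

Replacing `α²/(α²+S)` by the larger `q` requires `F 0 ≥ 0`, although `X̄` need not be a minimiser.
The lower half of the Łojasiewicz inequality also bounds the mean gap by `(1 + S/(α²+S)) · F 0`. A
negative gap would therefore diverge geometrically to `-∞` over the infinitely many epochs, whereas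
Łojasiewicz and the gradient bound keep it bounded below (`nonneg_of_geometric_of_bddBelow`). Since
the event was arbitrary, the conditional bound follows. -/

/-! ### Frobenius inner product and Euclidean gradients -/

noncomputable instance matInnerProductSpace {d r : ℕ} : InnerProductSpace ℝ (Mat d r) where
  inner A B := ∑ i, ∑ j, A i j * B i j
  norm_sq_eq_re_inner A := by
    rw [Matrix.frobenius_norm_def, ← Real.sqrt_eq_rpow, Real.sq_sqrt (by positivity)]
    simp [pow_two]
  conj_inner_symm A B := by simp [mul_comm]
  add_left A B C := by simp [add_mul, Finset.sum_add_distrib]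
  smul_left A B c := by simp [Finset.mul_sum, mul_assoc]

lemma inner_def {d r : ℕ} (A B : Mat d r) : inner ℝ A B = ∑ i, ∑ j, A i j * B i j := rfl

lemma inner_eq_trace {d r : ℕ} (A B : Mat d r) : inner ℝ A B = (Aᵀ * B).trace := by
  rw [inner_def, Finset.sum_comm]
  simp [Matrix.trace, Matrix.mul_apply]

lemma inner_mul_left {d r m : ℕ} (M : Mat d m) (A : Mat m r) (B : Mat d r) :
    inner ℝ (M * A) B = inner ℝ A (Mᵀ * B) := by
  simp [inner_eq_trace, Matrix.mul_assoc]

lemma inner_transpose {d r : ℕ} (A B : Mat d r) : inner ℝ Aᵀ Bᵀ = inner ℝ A B := by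
  rw [inner_def, inner_def, Finset.sum_comm]
  rfl

lemma norm_transpose {d r : ℕ} (A : Mat d r) : ‖Aᵀ‖ ^ 2 = ‖A‖ ^ 2 := by
  rw [← real_inner_self_eq_norm_sq, ← real_inner_self_eq_norm_sq, inner_transpose]

lemma fderiv_eq_inner_euclGrad {d r : ℕ} (f : Mat d r → ℝ) (X Z : Mat d r) :
    fderiv ℝ f X Z = inner ℝ (euclGrad f X) Z := by
  conv_lhs => rw [Matrix.matrix_eq_sum_single Z]
  rw [inner_def, map_sum]
  refine Finset.sum_congr rfl fun i _ => ?_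
  rw [map_sum]
  refine Finset.sum_congr rfl fun j _ => ?_
  have : Matrix.single i j (Z i j) = Z i j • Matrix.single i j (1 : ℝ) := by simp
  rw [this, map_smul]
  simp [euclGrad, mul_comm]

lemma euclGrad_objective {d r n : ℕ} (f : Fin n → Mat d r → ℝ) (X : Mat d r)
    (h : ∀ i, DifferentiableAt ℝ (f i) X) :
    euclGrad (objective f) X = (1 / (n : ℝ)) • ∑ i, euclGrad (f i) X := by
  have : HasFDerivAt (objective f) ((1 / (n : ℝ)) • ∑ i, fderiv ℝ (f i) X) X := by
    unfold objective
    exact (HasFDerivAt.fun_sum fun i _ => (h i).hasFDerivAt).const_mul _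
  ext a b
  simp only [euclGrad, this.fderiv, Matrix.of_apply]
  simp [Matrix.sum_apply]

lemma norm_sq_of_mem_stiefel {d r : ℕ} {X : Mat d r} (hX : X ∈ Stiefel d r) : ‖X‖ ^ 2 = r := by
  rw [← real_inner_self_eq_norm_sq, inner_eq_trace, show Xᵀ * X = 1 from hX]
  simp

lemma norm_of_mem_stiefel {d r : ℕ} {X : Mat d r} (hX : X ∈ Stiefel d r) : ‖X‖ = √(r : ℝ) := by
  rw [← norm_sq_of_mem_stiefel hX, Real.sqrt_sq (norm_nonneg _)]

/-- `D_ρ(X, ·)` as a linear map. -/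
noncomputable def dirOpLin {d r : ℕ} (ρ : ℝ) (X : Mat d r) : Mat d r →ₗ[ℝ] Mat d r where
  toFun := dirOp ρ X
  map_add' Y Z := by
    simp only [dirOp, skewPart, Matrix.mul_add, Matrix.transpose_add, Matrix.mul_smul,
      Matrix.mul_sub]
    module
  map_smul' a Y := by
    simp only [dirOp, skewPart, Matrix.transpose_smul, Matrix.mul_smul, Matrix.mul_sub,
      RingHom.id_apply]
    module

@[simp] lemma dirOpLin_apply {d r : ℕ} (ρ : ℝ) (X Y : Mat d r) :
    dirOpLin ρ X Y = dirOp ρ X Y := rfl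

lemma inner_skewPart {r : ℕ} (A : Matrix (Fin r) (Fin r) ℝ) :
    inner ℝ (A : Mat r r) (skewPart A : Mat r r) = ‖(skewPart A : Mat r r)‖ ^ 2 := by
  have h := inner_transpose (d := r) (r := r) A Aᵀ
  rw [Matrix.transpose_transpose] at h
  have h2 := norm_transpose (d := r) (r := r) A
  rw [← real_inner_self_eq_norm_sq]
  unfold skewPart
  simp only [real_inner_smul_left, real_inner_smul_right, inner_sub_left, inner_sub_right]
  simp only [real_inner_self_eq_norm_sq]
  rw [h2, h]; ring

/-! ### Geometry of the direction operator `dirOp` -/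

section
variable {d r : ℕ} {X : Mat d r} (hX : X ∈ Stiefel d r) (ρ : ℝ) (Y : Mat d r)
include hX

lemma transpose_mul_proj : Xᵀ * ((1 - X * Xᵀ) * Y) = 0 := by
  have h : Xᵀ * X = 1 := hX
  rw [← Matrix.mul_assoc, Matrix.mul_sub, ← Matrix.mul_assoc, h]
  simp

lemma inner_mul_stiefel (A B : Mat r r) : inner ℝ (X * A) (X * B) = inner ℝ A B := by
  have h : Xᵀ * X = 1 := hX
  rw [inner_mul_left, ← Matrix.mul_assoc, h, Matrix.one_mul]

lemma dirOp_mem_tangentAt : dirOp ρ X Y ∈ TangentAt X := by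
  have h : Xᵀ * X = 1 := hX
  have h1 : Xᵀ * dirOp ρ X Y = (4 * ρ) • skewPart (Xᵀ * Y) := by
    rw [dirOp, Matrix.mul_add, transpose_mul_proj hX, zero_add, Matrix.mul_smul,
      ← Matrix.mul_assoc, h, Matrix.one_mul]
  have h2 : (dirOp ρ X Y)ᵀ * X = (Xᵀ * dirOp ρ X Y)ᵀ := by simp
  show Xᵀ * dirOp ρ X Y + (dirOp ρ X Y)ᵀ * X = 0
  rw [h2, h1]
  ext i j
  simp [skewPart]
  ring

lemma inner_proj_self : inner ℝ Y ((1 - X * Xᵀ) * Y) = ‖(1 - X * Xᵀ) * Y‖ ^ 2 := by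
  rw [← real_inner_self_eq_norm_sq]
  nth_rw 2 [Matrix.sub_mul]
  rw [inner_sub_left, Matrix.one_mul, Matrix.mul_assoc, inner_mul_left, transpose_mul_proj hX,
    inner_zero_right, sub_zero]

/-- Pythagoras: the projected part is orthogonal to the range of left multiplication by `X`, and
that multiplication is an isometry. -/
lemma norm_dirOp_sq : ‖dirOp ρ X Y‖ ^ 2 =
    ‖(1 - X * Xᵀ) * Y‖ ^ 2 + (4 * ρ) ^ 2 * ‖(skewPart (Xᵀ * Y) : Mat r r)‖ ^ 2 := by
  have h0 : inner ℝ ((1 - X * Xᵀ) * Y) (X * skewPart (Xᵀ * Y)) = 0 := by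
    rw [real_inner_comm, inner_mul_left, transpose_mul_proj hX, inner_zero_right]
  rw [dirOp, ← real_inner_self_eq_norm_sq]
  simp only [inner_add_left, inner_add_right, real_inner_smul_left, real_inner_smul_right, h0,
    real_inner_comm _ (X * skewPart (Xᵀ * Y)), inner_mul_stiefel hX]
  simp only [real_inner_self_eq_norm_sq]
  ring

lemma inner_dirOp : inner ℝ Y (dirOp ρ X Y) =
    ‖(1 - X * Xᵀ) * Y‖ ^ 2 + 4 * ρ * ‖(skewPart (Xᵀ * Y) : Mat r r)‖ ^ 2 := by
  rw [dirOp, inner_add_right, real_inner_smul_right, inner_proj_self hX,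
    real_inner_comm (X * skewPart (Xᵀ * Y)) Y, inner_mul_left, real_inner_comm, inner_skewPart]

end

lemma nu_pos {ρ : ℝ} (hρ : 0 ≤ ρ) : 0 < nu ρ := by
  unfold nu
  split_ifs with h
  · exact one_pos
  · have : 0 < ρ := lt_of_le_of_ne hρ (Ne.symm h)
    positivity

lemma nu_le_one (ρ : ℝ) : nu ρ ≤ 1 := by
  unfold nu
  split_ifs
  · exact le_rfl
  · exact min_le_left _ _

lemma four_mul_nu_le {ρ : ℝ} (hρ : 0 ≤ ρ) : 4 * ρ * nu ρ ≤ 1 := by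
  unfold nu
  split_ifs with h
  · simp [h]
  · have : 0 < ρ := lt_of_le_of_ne hρ (Ne.symm h)
    calc 4 * ρ * min 1 (1 / (4 * ρ)) ≤ 4 * ρ * (1 / (4 * ρ)) := by
          gcongr; exact min_le_right _ _
      _ = 1 := by field_simp

/-- On the two orthogonal components the inequality reduces to `ν ≤ 1` and `4ρν ≤ 1`; this is the
reason for the definition of `ν`. -/
lemma nu_mul_norm_dirOp_sq_le {d r : ℕ} {X : Mat d r} (hX : X ∈ Stiefel d r) {ρ : ℝ} (hρ : 0 ≤ ρ)
    (Y : Mat d r) : nu ρ * ‖dirOp ρ X Y‖ ^ 2 ≤ inner ℝ Y (dirOp ρ X Y) := by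
  rw [norm_dirOp_sq hX, inner_dirOp hX, mul_add]
  refine add_le_add (mul_le_of_le_one_left (by positivity) (nu_le_one ρ)) ?_
  calc nu ρ * ((4 * ρ) ^ 2 * ‖(skewPart (Xᵀ * Y) : Mat r r)‖ ^ 2)
      = (4 * ρ * nu ρ) * (4 * ρ * ‖(skewPart (Xᵀ * Y) : Mat r r)‖ ^ 2) := by ring
    _ ≤ _ := mul_le_of_le_one_left (by positivity) (four_mul_nu_le hρ)

lemma norm_dirOp_le {d r : ℕ} {X : Mat d r} (hX : X ∈ Stiefel d r) {ρ : ℝ} (hρ : 0 ≤ ρ)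
    (Y : Mat d r) : nu ρ ^ 2 * ‖dirOp ρ X Y‖ ^ 2 ≤ ‖Y‖ ^ 2 := by
  have h1 := nu_mul_norm_dirOp_sq_le hX hρ Y
  have h2 := real_inner_le_norm Y (dirOp ρ X Y)
  have h3 : nu ρ * ‖dirOp ρ X Y‖ ≤ ‖Y‖ := by
    rcases (norm_nonneg (dirOp ρ X Y)).eq_or_lt with h | h
    · rw [← h]; simp
    · exact le_of_mul_le_mul_right (by linarith [h1, h2]) h
  rw [← mul_pow]
  exact pow_le_pow_left₀ (mul_nonneg (nu_pos hρ).le (norm_nonneg _)) h3 2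

/-- The quadratic upper bound for a function whose gradient is Lipschitz on a convex set. -/
lemma le_quadratic_of_lipschitz {d r : ℕ} {S : Set (Mat d r)} (hS : Convex ℝ S) {f : Mat d r → ℝ}
    {L : ℝ} (hd : ∀ X ∈ S, DifferentiableAt ℝ f X)
    (hl : ∀ X ∈ S, ∀ Y ∈ S, ‖euclGrad f X - euclGrad f Y‖ ≤ L * ‖X - Y‖)
    {X Y : Mat d r} (hX : X ∈ S) (hY : Y ∈ S) :
    f Y ≤ f X + inner ℝ (euclGrad f X) (Y - X) + L / 2 * ‖Y - X‖ ^ 2 := by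
  set V := Y - X with hV
  have hmem : ∀ t ∈ Set.Icc (0 : ℝ) 1, X + t • V ∈ S := fun t ht =>
    hS.add_smul_sub_mem hX hY ht
  -- The defect along the segment; the Lipschitz bound makes its derivative nonpositive, so
  -- comparing the endpoints gives the claim.
  let h : ℝ → ℝ := fun t => f (X + t • V) - t * inner ℝ (euclGrad f X) V - L / 2 * ‖V‖ ^ 2 * t ^ 2
  have hder : ∀ t ∈ Set.Icc (0 : ℝ) 1, HasDerivAt h
      (inner ℝ (euclGrad f (X + t • V)) V - inner ℝ (euclGrad f X) V - L * ‖V‖ ^ 2 * t) t := by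
    intro t ht
    have h1 : HasDerivAt (fun t : ℝ => X + t • V) V t := by
      have := ((hasDerivAt_id t).smul_const V).const_add X
      rwa [one_smul] at this
    have h2 : HasDerivAt (fun t : ℝ => f (X + t • V)) (inner ℝ (euclGrad f (X + t • V)) V) t := by
      rw [← fderiv_eq_inner_euclGrad]
      exact (hd _ (hmem t ht)).hasFDerivAt.comp_hasDerivAt t h1
    have h3 := (h2.sub ((hasDerivAt_id t).mul_const (inner ℝ (euclGrad f X) V))).sub
      ((hasDerivAt_pow 2 t).const_mul (L / 2 * ‖V‖ ^ 2))
    refine h3.congr_deriv ?_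
    push_cast
    ring
  have hanti : AntitoneOn h (Set.Icc 0 1) := by
    refine antitoneOn_of_deriv_nonpos (convex_Icc 0 1)
      (fun t ht => (hder t ht).continuousAt.continuousWithinAt) ?_ ?_
    · intro t ht
      exact (hder t (interior_subset ht)).differentiableAt.differentiableWithinAt
    · intro t ht
      have ht' := interior_subset ht
      rw [(hder t ht').deriv, ← inner_sub_left]
      have h1 := real_inner_le_norm (euclGrad f (X + t • V) - euclGrad f X) V
      have h2 := hl _ (hmem t ht') X hX
      rw [add_sub_cancel_left, norm_smul, Real.norm_of_nonneg ht'.1] at h2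
      nlinarith [norm_nonneg V]
  have := hanti (Set.left_mem_Icc.2 zero_le_one) (Set.right_mem_Icc.2 zero_le_one) zero_le_one
  simp only [h, one_smul, zero_smul, add_zero, zero_mul, one_mul] at this
  rw [show X + V = Y by simp [hV]] at this
  linarith

/-! ### Averages over mini-batches -/

section Average

variable {E : Type*} [NormedAddCommGroup E] [InnerProductSpace ℝ E] {n : ℕ}

lemma sum_batch_succ {M : Type*} [AddCommMonoid M] {b : ℕ} (φ : (Fin (b + 1) → Fin n) → M) :
    ∑ u, φ u = ∑ i : Fin n, ∑ u : Fin b → Fin n, φ (Fin.cons i u) := by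
  rw [← (Fin.consEquiv (fun _ : Fin (b + 1) => Fin n)).sum_comp, Fintype.sum_prod_type]
  rfl

omit [InnerProductSpace ℝ E] in
lemma sum_batch_sum_eq_zero (w : Fin n → E) (hw : ∑ i, w i = 0) (b : ℕ) :
    ∑ u : Fin b → Fin n, ∑ j, w (u j) = 0 := by
  induction b with
  | zero => simp
  | succ b ih =>
    rw [sum_batch_succ]
    simp only [Fin.sum_univ_succ, Fin.cons_zero, Fin.cons_succ, Finset.sum_add_distrib, ih,
      Finset.sum_const, add_zero]
    rw [← Finset.smul_sum, hw, smul_zero]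

/-- The variance of a sum of independent centred draws is additive: in the induction on `b` the
cross term vanishes because the draws have mean zero. The factor `n` on the left avoids division. -/
lemma sum_batch_norm_sq (w : Fin n → E) (hw : ∑ i, w i = 0) (b : ℕ) :
    n * ∑ u : Fin b → Fin n, ‖∑ j, w (u j)‖ ^ 2 = n ^ b * b * ∑ i, ‖w i‖ ^ 2 := by
  induction b with
  | zero => simp
  | succ b ih =>
    rw [sum_batch_succ]
    simp only [Fin.sum_univ_succ, Fin.cons_zero, Fin.cons_succ, norm_add_sq_real,
      Finset.sum_add_distrib, Finset.sum_const, ← Finset.mul_sum, ← inner_sum,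
      sum_batch_sum_eq_zero w hw, inner_zero_right]
    simp only [Finset.card_univ, Fintype.card_pi, Fintype.card_fin, Finset.prod_const,
      nsmul_eq_mul, ← Finset.mul_sum]
    push_cast
    linear_combination (n : ℝ) * ih

/-- The uniform average over all mini-batches. -/
noncomputable def batchAvg {n b : ℕ} (φ : (Fin b → Fin n) → ℝ) : ℝ := ∑ u, 1 / (n : ℝ) ^ b * φ u

lemma batchAvg_mono {n b : ℕ} {φ ψ : (Fin b → Fin n) → ℝ} (h : ∀ u, φ u ≤ ψ u) :
    batchAvg φ ≤ batchAvg ψ :=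
  Finset.sum_le_sum fun u _ => mul_le_mul_of_nonneg_left (h u) (by positivity)

lemma batchAvg_add {n b : ℕ} (φ ψ : (Fin b → Fin n) → ℝ) :
    batchAvg (fun u => φ u + ψ u) = batchAvg φ + batchAvg ψ := by
  simp [batchAvg, mul_add, Finset.sum_add_distrib]

lemma batchAvg_const_mul {n b : ℕ} (a : ℝ) (φ : (Fin b → Fin n) → ℝ) :
    batchAvg (fun u => a * φ u) = a * batchAvg φ := by
  simp only [batchAvg, Finset.mul_sum]
  exact Finset.sum_congr rfl fun u _ => by ring

lemma batchAvg_const {n b : ℕ} (hn : 1 ≤ n) (a : ℝ) :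
    batchAvg (fun _ : Fin b → Fin n => a) = a := by
  have : (n : ℝ) ≠ 0 := by positivity
  simp [batchAvg]
  field_simp

lemma batchAvg_inner_mean {b : ℕ} (w : Fin n → E) (hw : ∑ i, w i = 0) (x : E) :
    batchAvg (fun u : Fin b → Fin n => inner ℝ x ((1 / (b : ℝ)) • ∑ j, w (u j))) = 0 := by
  simp only [real_inner_smul_right]
  rw [batchAvg_const_mul, batchAvg, ← Finset.mul_sum, ← inner_sum, sum_batch_sum_eq_zero w hw]
  simp

lemma batchAvg_norm_sq_mean {b : ℕ} (hn : 1 ≤ n) (hb : 1 ≤ b) (w : Fin n → E)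
    (hw : ∑ i, w i = 0) :
    batchAvg (fun u : Fin b → Fin n => ‖(1 / (b : ℝ)) • ∑ j, w (u j)‖ ^ 2) =
      1 / b * (1 / n * ∑ i, ‖w i‖ ^ 2) := by
  have h := sum_batch_norm_sq w hw b
  have hn' : (n : ℝ) ≠ 0 := by positivity
  have hb' : (b : ℝ) ≠ 0 := by positivity
  simp only [norm_smul, mul_pow]
  rw [batchAvg_const_mul, batchAvg, ← Finset.mul_sum]
  simp only [norm_div, norm_one, Real.norm_natCast]
  field_simp
  linear_combination h

/-- Variance is at most the second moment. -/
lemma sum_norm_sub_mean_sq_le (hn : 1 ≤ n) (v : Fin n → E) :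
    ∑ i, ‖v i - (1 / (n : ℝ)) • ∑ k, v k‖ ^ 2 ≤ ∑ i, ‖v i‖ ^ 2 := by
  have hn' : (n : ℝ) ≠ 0 := by positivity
  set m := (1 / (n : ℝ)) • ∑ k, v k with hm
  have hs : ∑ k, v k = (n : ℝ) • m := by rw [hm, smul_smul]; field_simp; simp
  simp only [norm_sub_sq_real, Finset.sum_add_distrib, Finset.sum_sub_distrib, ← Finset.mul_sum,
    ← sum_inner, hs, real_inner_smul_left, real_inner_self_eq_norm_sq, Finset.sum_const,
    Finset.card_univ, Fintype.card_fin, nsmul_eq_mul]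
  nlinarith [mul_nonneg (Nat.cast_nonneg (α := ℝ) n) (sq_nonneg ‖m‖)]

lemma sum_sub_mean (hn : 1 ≤ n) (v : Fin n → E) :
    ∑ i, (v i - (1 / (n : ℝ)) • ∑ k, v k) = 0 := by
  have hn' : (n : ℝ) ≠ 0 := by positivity
  rw [Finset.sum_sub_distrib, Finset.sum_const, Finset.card_univ, Fintype.card_fin,
    ← Nat.cast_smul_eq_nsmul ℝ, smul_smul]
  field_simp
  simp

end Average

/-! ### One step of the algorithm -/

section Step

variable {d r n b : ℕ} {f : Fin n → Mat d r → ℝ} {L C ρ L₁ L₂ τ β : ℝ}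
  {R : Mat d r → Mat d r → Mat d r} {X₀ X : Mat d r}

/-- The deviation of the `i`-th component in the variance-reduced gradient from its mean. -/
noncomputable def deviation (f : Fin n → Mat d r → ℝ) (X₀ X : Mat d r) (i : Fin n) : Mat d r :=
  euclGrad (f i) X - euclGrad (f i) X₀ -
    (1 / (n : ℝ)) • ∑ k, (euclGrad (f k) X - euclGrad (f k) X₀)

lemma sum_deviation (hn : 1 ≤ n) : ∑ i, deviation f X₀ X i = 0 :=
  sum_sub_mean hn fun i => euclGrad (f i) X - euclGrad (f i) X₀

lemma svrgGrad_eq (hb : 1 ≤ b) (hX₀ : ∀ i, DifferentiableAt ℝ (f i) X₀)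
    (hX : ∀ i, DifferentiableAt ℝ (f i) X) (u : Fin b → Fin n) :
    svrgGrad f X₀ u X = euclGrad (objective f) X + (1 / (b : ℝ)) • ∑ j, deviation f X₀ X (u j) := by
  have hb' : (b : ℝ) ≠ 0 := by positivity
  rw [svrgGrad, euclGrad_objective f X hX, euclGrad_objective f X₀ hX₀]
  simp only [deviation]
  rw [Finset.sum_sub_distrib (s := (Finset.univ : Finset (Fin b))) (f := fun j =>
    euclGrad (f (u j)) X - euclGrad (f (u j)) X₀), Finset.sum_const, Finset.card_univ,
    Fintype.card_fin, ← Nat.cast_smul_eq_nsmul ℝ, smul_sub, smul_smul (1 / (b : ℝ)),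
    one_div_mul_cancel hb', one_smul, Finset.sum_sub_distrib (s := (Finset.univ : Finset (Fin n)))]
  module

lemma dirOp_svrgGrad (hb : 1 ≤ b) (hX₀ : ∀ i, DifferentiableAt ℝ (f i) X₀)
    (hX : ∀ i, DifferentiableAt ℝ (f i) X) (u : Fin b → Fin n) :
    dirOp ρ X (svrgGrad f X₀ u X) =
      riemGrad ρ (objective f) X + (1 / (b : ℝ)) • ∑ j, dirOp ρ X (deviation f X₀ X (u j)) := by
  rw [svrgGrad_eq hb hX₀ hX, ← dirOpLin_apply, map_add, map_smul, map_sum]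
  rfl

lemma sum_dirOp_deviation (hn : 1 ≤ n) : ∑ i, dirOp ρ X (deviation f X₀ X i) = 0 := by
  simp only [← dirOpLin_apply]
  rw [← map_sum, sum_deviation hn, map_zero]

lemma batchAvg_inner_dirOp (hn : 1 ≤ n) (hb : 1 ≤ b) (hX₀ : ∀ i, DifferentiableAt ℝ (f i) X₀)
    (hX : ∀ i, DifferentiableAt ℝ (f i) X) (Z : Mat d r) :
    batchAvg (fun u : Fin b → Fin n => inner ℝ Z (dirOp ρ X (svrgGrad f X₀ u X))) =
      inner ℝ Z (riemGrad ρ (objective f) X) := by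
  simp only [dirOp_svrgGrad hb hX₀ hX, inner_add_right]
  rw [batchAvg_add, batchAvg_const hn, batchAvg_inner_mean _ (sum_dirOp_deviation hn), add_zero]

/-- Bias-variance decomposition: the direction is the Riemannian gradient plus a centred mean of `b`
draws. Averaging costs `1/b`, `dirOp` costs `1/ν²`, and the Lipschitz condition bounds the second
moment by the squared drift. -/
lemma batchAvg_norm_dirOp_sq_le (hn : 1 ≤ n) (hb : 1 ≤ b) (hρ : 0 ≤ ρ)
    (hX₀ : ∀ i, DifferentiableAt ℝ (f i) X₀) (hX : ∀ i, DifferentiableAt ℝ (f i) X)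
    (hXs : X ∈ Stiefel d r)
    (hlip : ∀ i, ‖euclGrad (f i) X - euclGrad (f i) X₀‖ ≤ L * ‖X - X₀‖) :
    batchAvg (fun u : Fin b → Fin n => ‖dirOp ρ X (svrgGrad f X₀ u X)‖ ^ 2) ≤
      ‖riemGrad ρ (objective f) X‖ ^ 2 + L ^ 2 / (nu ρ ^ 2 * b) * ‖X - X₀‖ ^ 2 := by
  have hν := nu_pos hρ
  have hb' : (0 : ℝ) < b := by positivity
  have hn' : (0 : ℝ) < n := by positivity
  simp only [dirOp_svrgGrad hb hX₀ hX, norm_add_sq_real]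
  rw [batchAvg_add, batchAvg_add, batchAvg_const hn, batchAvg_const_mul,
    batchAvg_inner_mean _ (sum_dirOp_deviation hn),
    batchAvg_norm_sq_mean hn hb _ (sum_dirOp_deviation hn), mul_zero, add_zero]
  refine add_le_add le_rfl ?_
  have h1 : nu ρ ^ 2 * ∑ i, ‖dirOp ρ X (deviation f X₀ X i)‖ ^ 2 ≤
      n * (L ^ 2 * ‖X - X₀‖ ^ 2) := by
    calc nu ρ ^ 2 * ∑ i, ‖dirOp ρ X (deviation f X₀ X i)‖ ^ 2
        ≤ ∑ i, ‖deviation f X₀ X i‖ ^ 2 := by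
          rw [Finset.mul_sum]
          exact Finset.sum_le_sum fun i _ => norm_dirOp_le hXs hρ _
      _ ≤ ∑ i, ‖euclGrad (f i) X - euclGrad (f i) X₀‖ ^ 2 := sum_norm_sub_mean_sq_le hn _
      _ ≤ ∑ i : Fin n, (L * ‖X - X₀‖) ^ 2 :=
          Finset.sum_le_sum fun i _ => pow_le_pow_left₀ (norm_nonneg _) (hlip i) 2
      _ = n * (L ^ 2 * ‖X - X₀‖ ^ 2) := by simp [mul_pow]
  have h2 : L ^ 2 / (nu ρ ^ 2 * b) * ‖X - X₀‖ ^ 2 =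
      1 / b * (1 / n * (n * (L ^ 2 * ‖X - X₀‖ ^ 2) / nu ρ ^ 2)) := by field_simp
  rw [h2]
  gcongr
  rw [le_div_iff₀ (by positivity)]
  linarith

lemma step_mem_stiefel (hR : IsRetraction R) (hX : X ∈ Stiefel d r) (Y : Mat d r) :
    R X (-(τ • dirOp ρ X Y)) ∈ Stiefel d r := by
  refine hR.maps X hX _ ?_
  have : -(τ • dirOp ρ X Y) = dirOp ρ X (-(τ • Y)) := by
    simp only [← dirOpLin_apply, map_neg, map_smul]
  rw [this]
  exact dirOp_mem_tangentAt hX ρ _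

lemma norm_step_sub_le (hR' : RetractionConstants R L₁ L₂) (hX : X ∈ Stiefel d r) (hτ : 0 ≤ τ)
    (Y : Mat d r) :
    ‖R X (-(τ • dirOp ρ X Y)) - X‖ ^ 2 ≤ L₁ ^ 2 * τ ^ 2 * ‖dirOp ρ X Y‖ ^ 2 ∧
      ‖R X (-(τ • dirOp ρ X Y)) - X + τ • dirOp ρ X Y‖ ≤ L₂ * τ ^ 2 * ‖dirOp ρ X Y‖ ^ 2 := by
  have hm : -dirOp ρ X Y ∈ TangentAt X := by
    have : -dirOp ρ X Y = dirOp ρ X (-Y) := by simp only [← dirOpLin_apply, map_neg]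
    rw [this]
    exact dirOp_mem_tangentAt hX ρ _
  have h1 := hR'.first X hX _ hm τ hτ
  have h2 := hR'.second X hX _ hm τ hτ
  rw [smul_neg, norm_neg] at h1 h2
  rw [sub_neg_eq_add] at h2
  refine ⟨?_, h2⟩
  calc _ ≤ (L₁ * τ * ‖dirOp ρ X Y‖) ^ 2 := pow_le_pow_left₀ (norm_nonneg _) h1 2
    _ = _ := by ring

lemma objective_step_le {F : Mat d r → ℝ}
    (hd : ∀ X ∈ convexHull ℝ (Stiefel d r), DifferentiableAt ℝ F X)
    (hl : ∀ X ∈ convexHull ℝ (Stiefel d r), ∀ Y ∈ convexHull ℝ (Stiefel d r),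
      ‖euclGrad F X - euclGrad F Y‖ ≤ L * ‖X - Y‖)
    (hL : 0 < L) (hC : ‖euclGrad F X‖ ≤ C)
    (hR : IsRetraction R) (hR' : RetractionConstants R L₁ L₂) (hX : X ∈ Stiefel d r) (hτ : 0 ≤ τ)
    (Y : Mat d r) :
    F (R X (-(τ • dirOp ρ X Y))) ≤
      F X + -τ * inner ℝ (euclGrad F X) (dirOp ρ X Y) +
        hatL L L₁ L₂ C / 2 * τ ^ 2 * ‖dirOp ρ X Y‖ ^ 2 := by
  have h1 := le_quadratic_of_lipschitz (convex_convexHull ℝ (Stiefel d r)) hd hl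
    (subset_convexHull ℝ _ hX) (subset_convexHull ℝ _ (step_mem_stiefel (τ := τ) (ρ := ρ) hR hX Y))
  obtain ⟨h2, h3⟩ := norm_step_sub_le (ρ := ρ) hR' hX hτ Y
  set D := dirOp ρ X Y
  set V := R X (-(τ • D)) - X
  -- The displacement is `-τ D` plus a second-order retraction error; the error yields the `2 L₂ C`
  -- part of `hatL`, the quadratic term the `L₁² L` part.
  have h4 : inner ℝ (euclGrad F X) V = inner ℝ (euclGrad F X) (V + τ • D)
      - τ * inner ℝ (euclGrad F X) D := by
    rw [inner_add_right, real_inner_smul_right]; ring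
  have h5 : inner ℝ (euclGrad F X) (V + τ • D) ≤ C * (L₂ * τ ^ 2 * ‖D‖ ^ 2) :=
    (real_inner_le_norm _ _).trans (mul_le_mul hC h3 (norm_nonneg _) ((norm_nonneg _).trans hC))
  have h6 := mul_le_mul_of_nonneg_left h2 (half_pos hL).le
  unfold hatL
  linarith

lemma dist_step_le (hR' : RetractionConstants R L₁ L₂) (hX : X ∈ Stiefel d r)
    (hX₀ : X₀ ∈ Stiefel d r) (hτ : 0 ≤ τ) (Y : Mat d r) :
    ‖R X (-(τ • dirOp ρ X Y)) - X₀‖ ^ 2 ≤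
      ‖X - X₀‖ ^ 2 + -(2 * τ) * inner ℝ (X - X₀) (dirOp ρ X Y) +
        tildeL L₁ L₂ r * τ ^ 2 * ‖dirOp ρ X Y‖ ^ 2 := by
  obtain ⟨h2, h3⟩ := norm_step_sub_le (ρ := ρ) hR' hX hτ Y
  set D := dirOp ρ X Y
  set V := R X (-(τ • D)) - X with hV
  have h1 : R X (-(τ • D)) - X₀ = (X - X₀) + V := by rw [hV]; abel
  have h4 : inner ℝ (X - X₀) V = inner ℝ (X - X₀) (V + τ • D) - τ * inner ℝ (X - X₀) D := by
    rw [inner_add_right, real_inner_smul_right]; ring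
  -- The manifold lies on the sphere of radius `√r`. This bound multiplies the retraction error and
  -- produces the `4 L₂ √r` in `tildeL`.
  have h0 : ‖X - X₀‖ ≤ 2 * √(r : ℝ) := by
    refine (norm_sub_le _ _).trans ?_
    rw [norm_of_mem_stiefel hX, norm_of_mem_stiefel hX₀]; linarith
  have h5 : inner ℝ (X - X₀) (V + τ • D) ≤ 2 * √(r : ℝ) * (L₂ * τ ^ 2 * ‖D‖ ^ 2) :=
    (real_inner_le_norm _ _).trans (mul_le_mul h0 h3 (norm_nonneg _) (by positivity))
  rw [h1, norm_add_sq_real]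
  unfold tildeL
  linarith

/-- The growth factor of the expected squared distance to the reference point is `1 + growth`. -/
noncomputable def growth (Lt L v β τ : ℝ) (b : ℕ) : ℝ :=
  2 * β * τ + Lt * L ^ 2 * τ ^ 2 / (v ^ 2 * b)

lemma one_le_tildeL (hR' : RetractionConstants R L₁ L₂) (r : ℕ) : 1 ≤ tildeL L₁ L₂ r := by
  have h1 := hR'.one_le
  have h2 := hR'.pos
  have : 0 ≤ 4 * L₂ * √(r : ℝ) := by positivity
  unfold tildeL
  nlinarith

lemma hatL_pos (hR' : RetractionConstants R L₁ L₂) (hL : 0 < L) (hC : 0 < C) :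
    0 < hatL L L₁ L₂ C := by
  have h1 := hR'.one_le
  have h2 := hR'.pos
  unfold hatL
  positivity

lemma batchAvg_objective_step_le (hn : 1 ≤ n) (hb : 1 ≤ b) (hL : 0 < L)
    (hdiff : ∀ i, ∀ X ∈ Stiefel d r, DifferentiableAt ℝ (f i) X)
    (hlip : ∀ i, ∀ X ∈ Stiefel d r, ∀ Y ∈ Stiefel d r,
      ‖euclGrad (f i) X - euclGrad (f i) Y‖ ≤ L * ‖X - Y‖)
    (hd : ∀ X ∈ convexHull ℝ (Stiefel d r), DifferentiableAt ℝ (objective f) X)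
    (hl : ∀ X ∈ convexHull ℝ (Stiefel d r), ∀ Y ∈ convexHull ℝ (Stiefel d r),
      ‖euclGrad (objective f) X - euclGrad (objective f) Y‖ ≤ L * ‖X - Y‖)
    (hC : 0 < C) (hbound : ∀ X ∈ Stiefel d r, ‖euclGrad (objective f) X‖ ≤ C)
    (hR : IsRetraction R) (hR' : RetractionConstants R L₁ L₂) (hρ : 0 ≤ ρ) (hτ : 0 ≤ τ)
    (hX₀ : X₀ ∈ Stiefel d r) (hX : X ∈ Stiefel d r) :
    batchAvg (fun u : Fin b → Fin n =>
        objective f (R X (-(τ • dirOp ρ X (svrgGrad f X₀ u X))))) ≤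
      objective f X - τ * (nu ρ - hatL L L₁ L₂ C * τ / 2) * ‖riemGrad ρ (objective f) X‖ ^ 2 +
        hatL L L₁ L₂ C / 2 * τ ^ 2 * (L ^ 2 / (nu ρ ^ 2 * b)) * ‖X - X₀‖ ^ 2 := by
  refine (batchAvg_mono fun u => objective_step_le hd hl hL (hbound X hX) hR hR' hX hτ _).trans ?_
  rw [batchAvg_add, batchAvg_add, batchAvg_const hn, batchAvg_const_mul, batchAvg_const_mul,
    batchAvg_inner_dirOp hn hb (fun i => hdiff i _ hX₀) (fun i => hdiff i _ hX)]
  have h1 := batchAvg_norm_dirOp_sq_le (b := b) hn hb hρ (fun i => hdiff i _ hX₀)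
    (fun i => hdiff i _ hX) hX (fun i => hlip i X hX X₀ hX₀)
  have h2 : nu ρ * ‖riemGrad ρ (objective f) X‖ ^ 2 ≤
      inner ℝ (euclGrad (objective f) X) (riemGrad ρ (objective f) X) :=
    nu_mul_norm_dirOp_sq_le hX hρ _
  have h3 := mul_le_mul_of_nonneg_left h1
    (show 0 ≤ hatL L L₁ L₂ C / 2 * τ ^ 2 by have := hatL_pos hR' hL hC; positivity)
  have h4 := mul_le_mul_of_nonneg_left h2 hτ
  linarith

lemma batchAvg_dist_step_le (hn : 1 ≤ n) (hb : 1 ≤ b)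
    (hdiff : ∀ i, ∀ X ∈ Stiefel d r, DifferentiableAt ℝ (f i) X)
    (hlip : ∀ i, ∀ X ∈ Stiefel d r, ∀ Y ∈ Stiefel d r,
      ‖euclGrad (f i) X - euclGrad (f i) Y‖ ≤ L * ‖X - Y‖)
    (hR' : RetractionConstants R L₁ L₂) (hρ : 0 ≤ ρ) (hτ : 0 < τ) (hβ : 0 < β)
    (hX₀ : X₀ ∈ Stiefel d r) (hX : X ∈ Stiefel d r) :
    batchAvg (fun u : Fin b → Fin n => ‖R X (-(τ • dirOp ρ X (svrgGrad f X₀ u X))) - X₀‖ ^ 2) ≤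
      (1 + growth (tildeL L₁ L₂ r) L (nu ρ) β τ b) * ‖X - X₀‖ ^ 2 +
        (tildeL L₁ L₂ r * τ ^ 2 + 2 * τ / β) * ‖riemGrad ρ (objective f) X‖ ^ 2 := by
  refine (batchAvg_mono fun u => dist_step_le hR' hX hX₀ hτ.le _).trans ?_
  rw [batchAvg_add, batchAvg_add, batchAvg_const hn, batchAvg_const_mul, batchAvg_const_mul,
    batchAvg_inner_dirOp hn hb (fun i => hdiff i _ hX₀) (fun i => hdiff i _ hX)]
  have h1 := batchAvg_norm_dirOp_sq_le (b := b) hn hb hρ (fun i => hdiff i _ hX₀)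
    (fun i => hdiff i _ hX) hX (fun i => hlip i X hX X₀ hX₀)
  have h3 := mul_le_mul_of_nonneg_left h1
    (show 0 ≤ tildeL L₁ L₂ r * τ ^ 2 by have := one_le_tildeL hR' r; positivity)
  set g := riemGrad ρ (objective f) X
  -- Young's inequality with weight `β`, in a non-sharp form; it makes `2βτ` appear in the growth
  -- factor and `2τ/β` in front of the gradient.
  have h2 : -inner ℝ (X - X₀) g ≤ β * ‖X - X₀‖ ^ 2 + 1 / β * ‖g‖ ^ 2 := by
    have h := neg_le_of_abs_le (abs_real_inner_le_norm (X - X₀) g)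
    have h' : 0 ≤ β * (‖X - X₀‖ - 1 / β * ‖g‖) ^ 2 := by positivity
    have e : β * (‖X - X₀‖ - 1 / β * ‖g‖) ^ 2 =
        β * ‖X - X₀‖ ^ 2 - 2 * (‖X - X₀‖ * ‖g‖) + 1 / β * ‖g‖ ^ 2 := by field_simp; ring
    nlinarith [mul_nonneg (norm_nonneg (X - X₀)) (norm_nonneg g)]
  have h4 := mul_le_mul_of_nonneg_left h2 hτ.le
  have e1 : growth (tildeL L₁ L₂ r) L (nu ρ) β τ b = 2 * β * τ +
    tildeL L₁ L₂ r * τ ^ 2 * (L ^ 2 / (nu ρ ^ 2 * b)) := by unfold growth; ring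
  have e2 : 2 * τ / β = 2 * τ * (1 / β) := by ring
  rw [e1, e2]
  linarith

end Step

/-! ### The weights -/

section Weights

variable {Lh Lt L v β τ : ℝ} {b K : ℕ}

lemma Del_eq (hLt : 0 < Lt) (hβ : 0 < β) (hτ : 0 < τ) (k : ℕ) :
    Del Lh Lt L v β τ b K k = τ * (v - Lh * τ / 2) -
      Lh / 2 * τ ^ 2 * (L ^ 2 / (v ^ 2 * b)) * Gam (growth Lt L v β τ b) (K - k) *
        (Lt * τ ^ 2 + 2 * τ / β) := by
  have h : Lt * τ ^ 2 + 2 * τ / β = (1 + 2 / (Lt * β * τ)) * (Lt * τ ^ 2) := by field_simp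
  rw [h, Del, growth]
  ring

/-- Telescoping the expected decrease over an epoch, for the integrals `F`, `E`, `G` of the
objective, the squared distance to the reference point and the squared gradient norm. -/
lemma epoch_decrease (hLh : 0 < Lh) (hLt : 0 < Lt) (hβ : 0 < β) (hτ : 0 < τ) {F E G : ℕ → ℝ}
    (hE₀ : E 0 = 0)
    (hF : ∀ k < K, F (k + 1) ≤ F k - τ * (v - Lh * τ / 2) * G k +
      Lh / 2 * τ ^ 2 * (L ^ 2 / (v ^ 2 * b)) * E k)
    (hE : ∀ k < K, E (k + 1) ≤ (1 + growth Lt L v β τ b) * E k +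
      (Lt * τ ^ 2 + 2 * τ / β) * G k)
    (hEnn : ∀ k, 0 ≤ E k) {k : ℕ} (hk : k ≤ K) :
    F k + ∑ j ∈ Finset.range k, Del Lh Lt L v β τ b K j * G j ≤ F 0 := by
  set z := growth Lt L v β τ b with hz
  have hz0 : 0 < z := by rw [hz, growth]; positivity
  set A := Lh / 2 * τ ^ 2 * (L ^ 2 / (v ^ 2 * b)) with hA
  have hA0 : 0 ≤ A := by rw [hA]; positivity
  -- Closed form of the backward recursion `a K = 0`, `a k = A + (1 + z) a (k + 1)`, chosen so that
  -- the drift terms cancel in `F k + a k * E k`.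
  let a : ℕ → ℝ := fun k => A * (((1 + z) ^ (K - k) - 1) / z)
  have ha : ∀ k, 0 ≤ a k := fun k => by
    have : 1 ≤ (1 + z) ^ (K - k) := one_le_pow₀ (by linarith)
    exact mul_nonneg hA0 (div_nonneg (by linarith) hz0.le)
  suffices h : ∀ k ≤ K,
      F k + a k * E k + ∑ j ∈ Finset.range k, Del Lh Lt L v β τ b K j * G j ≤ F 0 by
    have := h k hk
    have := mul_nonneg (ha k) (hEnn k)
    linarith
  intro k
  induction k with
  | zero => simp [hE₀]
  | succ k ih =>
    intro hk
    have ih := ih (by omega)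
    have e1 : a k = A + (1 + z) * a (k + 1) := by
      have : K - k = K - (k + 1) + 1 := by omega
      simp only [a]
      rw [this, pow_succ]
      field_simp
      ring
    -- The exponent `i - 1` in `Gam` shifts the index: the drift created at step `k` is charged with
    -- the coefficient of step `k + 1`.
    have e2 : A * Gam z (K - k) = a (k + 1) := by
      simp only [a, Gam]
      rw [show K - k - 1 = K - (k + 1) by omega]
    rw [Finset.sum_range_succ, Del_eq hLt hβ hτ, ← hz, ← hA, e2]
    have h1 := hF k (by omega)
    have h2 := mul_le_mul_of_nonneg_left (hE k (by omega)) (ha (k + 1))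
    rw [e1] at ih
    linarith

end Weights

/-! ### Consequences of the parameter choices -/

section Parameters

variable {Lh Lt L v μ κ c β τ : ℝ} {n K b : ℕ}

/-- Since `βτ = c/K` and the batch size gives `y K ≤ c²`, the growth `z` satisfies `z K ≤ c² + 2c`,
so compounding over an epoch costs at most `exp (c² + 2c)`. The bracket in `Del` is then at most
`K^μ exp (c² + 2c)`; the factor `K^{-μ}` in `τ` cancels `K^μ`, and the condition on `c` leaves half
of `ν`. -/
lemma half_le_Del (hLh : 0 < Lh) (hLt : 1 ≤ Lt) (hL : 0 < L) (hv : 0 < v)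
    (hμ₀ : 0 ≤ μ) (hμ₁ : μ ≤ 2 / 3) (hc₀ : 0 < c)
    (hc : Lh / (√Lt * L) * Real.exp (c ^ 2 + 2 * c) * c ≤ 1) (hK : 1 ≤ K)
    (hb : b = ⌈(K : ℝ) ^ (2 - 3 * μ)⌉₊)
    (hβ : β = √Lt * L / v * (K : ℝ) ^ (μ - 1))
    (hτ : τ = c * v / (√Lt * L) * (K : ℝ) ^ (-μ)) (k : ℕ) :
    τ * v / 2 ≤ Del Lh Lt L v β τ b K k := by
  have hK0 : (0 : ℝ) < K := by positivity
  have hK1 : (1 : ℝ) ≤ K := by exact_mod_cast hK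
  have hs : 0 < √Lt := Real.sqrt_pos.2 (by linarith)
  have hs2 : √Lt ^ 2 = Lt := Real.sq_sqrt (by linarith)
  have hp : 0 < (K : ℝ) ^ μ := Real.rpow_pos_of_pos hK0 _
  have hp1 : 1 ≤ (K : ℝ) ^ μ := Real.one_le_rpow hK1 hμ₀
  have hτ' : τ = c * v / (√Lt * L) / (K : ℝ) ^ μ := by rw [hτ, Real.rpow_neg hK0.le]; rfl
  have hβ' : β = √Lt * L / v * ((K : ℝ) ^ μ / K) := by rw [hβ, Real.rpow_sub_one hK0.ne']
  have hτ0 : 0 < τ := by rw [hτ']; positivity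
  have hβτ : β * τ = c / K := by rw [hβ', hτ']; field_simp
  have hb1 : (K : ℝ) ^ (2 - 3 * μ) ≤ b := by rw [hb]; exact Nat.le_ceil _
  have hb1' : (K : ℝ) ^ 2 / ((K : ℝ) ^ μ) ^ 3 ≤ b := by
    have : (K : ℝ) ^ (2 - 3 * μ) = (K : ℝ) ^ 2 / ((K : ℝ) ^ μ) ^ 3 := by
      rw [Real.rpow_sub hK0, mul_comm, Real.rpow_mul hK0.le]; norm_cast
    rwa [← this]
  have hb0 : (0 : ℝ) < b := lt_of_lt_of_le (Real.rpow_pos_of_pos hK0 _) hb1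
  set p := (K : ℝ) ^ μ with hpdef
  set y := Lt * L ^ 2 * τ ^ 2 / (v ^ 2 * b) with hy
  have hy' : y = c ^ 2 / (p ^ 2 * b) := by
    rw [hy, hτ']; nth_rw 1 [← hs2]; field_simp
  have hy0 : 0 < y := by rw [hy']; positivity
  have hpK : p ≤ K := by
    rw [hpdef]; exact (Real.rpow_le_rpow_of_exponent_le hK1 (by linarith)).trans_eq (Real.rpow_one _)
  have hyK2 : y * K ^ 2 ≤ c ^ 2 * p := by
    rw [hy', div_mul_eq_mul_div, div_le_iff₀ (by positivity)]
    rw [div_le_iff₀ (by positivity)] at hb1'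
    nlinarith [mul_le_mul_of_nonneg_left hb1' (sq_nonneg c)]
  have hyK : y * K ≤ c ^ 2 := by
    refine le_of_mul_le_mul_right ?_ hK0
    nlinarith [mul_le_mul_of_nonneg_left hpK (sq_nonneg c)]
  set z := 2 * β * τ + y with hz
  have hz' : z = 2 * (c / K) + y := by rw [hz, ← hβτ]; ring
  have hz0 : 0 < z := by rw [hz']; positivity
  set T := Real.exp (c ^ 2 + 2 * c) with hT
  have hzK : z * K ≤ c ^ 2 + 2 * c := by
    have : z * K = 2 * c + y * K := by rw [hz']; field_simp
    linarith
  have hpow : (1 + z) ^ (K - k - 1) ≤ T := by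
    calc (1 + z) ^ (K - k - 1) ≤ (1 + z) ^ K := pow_le_pow_right₀ (by linarith) (by omega)
      _ ≤ Real.exp z ^ K := pow_le_pow_left₀ (by linarith) (by linarith [Real.add_one_le_exp z]) _
      _ = Real.exp (z * K) := by rw [← Real.exp_nat_mul, mul_comm]
      _ ≤ T := Real.exp_le_exp.2 hzK
  have hT1 : 0 ≤ T - 1 := by
    have : 1 ≤ T := Real.one_le_exp (by positivity)
    linarith
  -- The second term of `z` pays for `y`, using `p ≥ 1`; the first pays for the Young term through
  -- `y K² ≤ c² p`, the bound that dictates the exponent `2 - 3μ` of the batch size.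
  have hcoef : (1 + 2 / (Lt * β * τ)) * y ≤ p * z := by
    have h1 : 2 / (Lt * β * τ) ≤ 2 * K / c := by
      rw [show Lt * β * τ = Lt * (c / K) by rw [← hβτ]; ring, div_le_div_iff₀ (by positivity) hc₀]
      calc 2 * c ≤ Lt * (2 * c) := le_mul_of_one_le_left (by positivity) hLt
        _ = 2 * K * (Lt * (c / K)) := by field_simp
    calc (1 + 2 / (Lt * β * τ)) * y ≤ (1 + 2 * K / c) * y := by gcongr
      _ = y + 2 / (c * K) * (y * K ^ 2) := by field_simp
      _ ≤ p * y + 2 / (c * K) * (c ^ 2 * p) := by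
          gcongr
          exact le_mul_of_one_le_left hy0.le hp1
      _ = p * z := by rw [hz']; field_simp; ring
  have hmain : (1 + 2 / (Lt * β * τ)) * y * Gam z (K - k) ≤ p * (T - 1) := by
    have h0 : 0 ≤ (1 + z) ^ (K - k - 1) - 1 := by
      have : 1 ≤ (1 + z) ^ (K - k - 1) := one_le_pow₀ (by linarith)
      linarith
    calc _ ≤ p * z * Gam z (K - k) :=
          mul_le_mul_of_nonneg_right hcoef (div_nonneg h0 hz0.le)
      _ = p * ((1 + z) ^ (K - k - 1) - 1) := by unfold Gam; field_simp
      _ ≤ _ := by gcongr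
  have hbr : 1 + (1 + 2 / (Lt * β * τ)) * y * Gam z (K - k) ≤ p * T := by nlinarith
  have hLτ : Lh * τ / 2 * (p * T) ≤ v / 2 := by
    have : Lh * τ / 2 * (p * T) = v / 2 * (Lh / (√Lt * L) * T * c) := by rw [hτ']; field_simp
    rw [this]
    exact mul_le_of_le_one_right (by positivity) hc
  have := mul_le_mul_of_nonneg_left hbr (show 0 ≤ Lh * τ / 2 by positivity)
  unfold Del
  rw [mul_div_assoc]
  refine mul_le_mul_of_nonneg_left ?_ hτ0.le
  linarith

lemma epoch_length_pos (hn : 1 ≤ n) (hκ : 0 < κ)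
    (hK : K = ⌈(κ * n) ^ (1 / (3 * (1 - μ)))⌉₊) : 1 ≤ K := by
  rw [hK]
  exact Nat.one_le_ceil_iff.2 (Real.rpow_pos_of_pos (by positivity) _)

lemma batch_size_pos (hK : 1 ≤ K) (hb : b = ⌈(K : ℝ) ^ (2 - 3 * μ)⌉₊) : 1 ≤ b := by
  rw [hb]
  exact Nat.one_le_ceil_iff.2 (Real.rpow_pos_of_pos (by positivity) _)

lemma rate_weight_le_sum_Del (hn : 1 ≤ n) (hκ : 0 < κ) (hLh : 0 < Lh) (hLt : 1 ≤ Lt) (hL : 0 < L)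
    (hv : 0 < v) (hμ₀ : 0 ≤ μ) (hμ₁ : μ ≤ 2 / 3) (hc₀ : 0 < c)
    (hc : Lh / (√Lt * L) * Real.exp (c ^ 2 + 2 * c) * c ≤ 1)
    (hK : K = ⌈(κ * n) ^ (1 / (3 * (1 - μ)))⌉₊)
    (hb : b = ⌈(K : ℝ) ^ (2 - 3 * μ)⌉₊)
    (hβ : β = √Lt * L / v * (K : ℝ) ^ (μ - 1))
    (hτ : τ = c * v / (√Lt * L) * (K : ℝ) ^ (-μ)) :
    c * v ^ 2 * (κ * n) ^ (1 / 3 : ℝ) / (2 * √Lt * L) ≤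
      ∑ j ∈ Finset.range K, Del Lh Lt L v β τ b K j := by
  have hK1 := epoch_length_pos hn hκ hK
  have hK0 : (0 : ℝ) < K := by positivity
  have hs : 0 < √Lt := Real.sqrt_pos.2 (by linarith)
  have hkn : 0 < κ * n := by positivity
  -- Raising the ceiling bound on `K` to the power `1 - μ` explains the exponent `1/(3(1 - μ))`.
  have hroot : (κ * n) ^ (1 / 3 : ℝ) ≤ K * (K : ℝ) ^ (-μ) := by
    have h1 : (κ * n) ^ (1 / (3 * (1 - μ))) ≤ (K : ℝ) := by
      rw [hK]; exact Nat.le_ceil _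
    have h2 := Real.rpow_le_rpow (Real.rpow_nonneg hkn.le _) h1 (show 0 ≤ 1 - μ by linarith)
    have hμ : 1 - μ ≠ 0 := by linarith
    rw [← Real.rpow_mul hkn.le, show 1 / (3 * (1 - μ)) * (1 - μ) = 1 / 3 by field_simp,
      sub_eq_add_neg, Real.rpow_add hK0, Real.rpow_one] at h2
    exact h2
  calc c * v ^ 2 * (κ * n) ^ (1 / 3 : ℝ) / (2 * √Lt * L)
      ≤ c * v ^ 2 * (K * (K : ℝ) ^ (-μ)) / (2 * √Lt * L) := by gcongr
    _ = ∑ j ∈ Finset.range K, τ * v / 2 := by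
        rw [Finset.sum_const, Finset.card_range, nsmul_eq_mul, hτ]; field_simp
    _ ≤ _ := Finset.sum_le_sum fun j _ =>
        half_le_Del hLh hLt hL hv hμ₀ hμ₁ hc₀ hc hK1 hb hβ hτ j

lemma div_le_rate {α S : ℝ} (hα : 0 < α) (hLt : 1 ≤ Lt) (hL : 0 < L) (hκ : 0 < κ) (hc₀ : 0 < c)
    (hS : c * v ^ 2 * (κ * n) ^ (1 / 3 : ℝ) / (2 * √Lt * L) ≤ S) :
    α ^ 2 / (α ^ 2 + S) ≤ rate Lt L α c v κ n := by
  have hs : 0 < √Lt := Real.sqrt_pos.2 (by linarith)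
  set W := c * v ^ 2 * (κ * n) ^ (1 / 3 : ℝ) with hW
  have hW0 : 0 ≤ W := by positivity
  have : rate Lt L α c v κ n = α ^ 2 / (α ^ 2 + W / (2 * √Lt * L)) := by
    rw [rate, ← hW]; field_simp
  rw [this]
  gcongr

lemma rate_nonneg {α : ℝ} (hL : 0 < L) (hκ : 0 < κ) (hc₀ : 0 < c) :
    0 ≤ rate Lt L α c v κ n := by
  unfold rate
  positivity

end Parameters

/-! ### Random variables with finitely many values -/

section Simple

variable {Ω : Type*} {α γ ι : Type*} {m m' : MeasurableSpace Ω}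

/-- `Y` takes finitely many values, each on an `m`-measurable set. -/
def IsSimple (m : MeasurableSpace Ω) (Y : Ω → α) : Prop := ∃ g : @SimpleFunc Ω m α, ⇑g = Y

lemma IsSimple.const (m : MeasurableSpace Ω) (a : α) : IsSimple m (fun _ : Ω => a) :=
  ⟨@SimpleFunc.const Ω α m a, rfl⟩

lemma IsSimple.comp {Y : Ω → α} (hY : IsSimple m Y) (h : α → γ) :
    IsSimple m (fun ω => h (Y ω)) := by
  obtain ⟨g, rfl⟩ := hY
  exact ⟨g.map h, rfl⟩

lemma IsSimple.select {Y : ι → Ω → α} {Z : Ω → ι} (hZ : IsSimple m Z) (hY : ∀ i, IsSimple m (Y i)) :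
    IsSimple m (fun ω => Y (Z ω) ω) := by
  obtain ⟨g, rfl⟩ := hZ
  choose y hy using hY
  refine ⟨g.bind y, ?_⟩
  funext ω
  rw [SimpleFunc.bind_apply, hy]

lemma IsSimple.comp₂ {β : Type*} {Y : Ω → α} {Z : Ω → β} (hY : IsSimple m Y) (hZ : IsSimple m Z)
    (h : α → β → γ) : IsSimple m (fun ω => h (Y ω) (Z ω)) :=
  IsSimple.select (Y := fun a ω => h a (Z ω)) hY fun a => hZ.comp (h a)

lemma IsSimple.mono {Y : Ω → α} (hY : IsSimple m Y) (h : m ≤ m') : IsSimple m' Y := by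
  obtain ⟨g, rfl⟩ := hY
  exact ⟨@SimpleFunc.mk Ω m' α (@SimpleFunc.toFun Ω m α g)
    (fun x => h _ (@SimpleFunc.measurableSet_fiber' Ω m α g x))
    (@SimpleFunc.finite_range' Ω m α g), rfl⟩

lemma IsSimple.of_comap_le [Finite α] [mα : MeasurableSpace α] [MeasurableSingletonClass α]
    {Y : Ω → α} (h : mα.comap Y ≤ m) : IsSimple m Y :=
  ⟨@SimpleFunc.mk Ω m α Y (fun x => h _ ⟨{x}, measurableSet_singleton x, rfl⟩)
    (Set.toFinite _), rfl⟩

lemma IsSimple.stronglyMeasurable {Y : Ω → ℝ} (hY : IsSimple m Y) : StronglyMeasurable[m] Y := by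
  obtain ⟨g, rfl⟩ := hY
  exact g.stronglyMeasurable

lemma IsSimple.indicator {Y : Ω → ℝ} (hY : IsSimple m Y) {A : Set Ω} (hA : MeasurableSet[m] A) :
    IsSimple m (A.indicator Y) := by
  obtain ⟨g, rfl⟩ := hY
  exact ⟨g.restrict A, SimpleFunc.coe_restrict g hA⟩

lemma IsSimple.integrable {mΩ : MeasurableSpace Ω} (hm : m ≤ mΩ) {P : Measure Ω}
    [IsFiniteMeasure P] {Y : Ω → ℝ} (hY : IsSimple m Y) : Integrable Y P := by
  obtain ⟨g, rfl⟩ := hY.mono hm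
  exact g.integrable_of_isFiniteMeasure

/-- Integrating out a finitely-valued variable that is independent of everything else. -/
lemma setIntegral_select_of_indep {mΩ : MeasurableSpace Ω} {P : Measure Ω} [IsProbabilityMeasure P]
    {U : Type*} [Fintype U] [mU : MeasurableSpace U] [MeasurableSingletonClass U] {ζ : Ω → U}
    (hζ : Measurable ζ) (hm : m ≤ mΩ) (hind : Indep (mU.comap ζ) m P) {Φ : U → Ω → ℝ}
    (hΦ : ∀ u, IsSimple m (Φ u)) {A : Set Ω} (hA : MeasurableSet[m] A) :
    ∫ ω in A, Φ (ζ ω) ω ∂P = ∑ u, P.real {ω | ζ ω = u} * ∫ ω in A, Φ u ω ∂P := by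
  classical
  have hmeas : ∀ u, MeasurableSet {ω | ζ ω = u} := fun u => hζ (measurableSet_singleton u)
  -- Splitting by the value of `ζ` turns the integrand into a finite sum of products of independent
  -- factors.
  have hdecomp : ∀ ω, A.indicator (fun ω => Φ (ζ ω) ω) ω =
      ∑ u, {ω | ζ ω = u}.indicator (fun _ => (1 : ℝ)) ω * A.indicator (Φ u) ω := by
    intro ω
    rw [Finset.sum_eq_single (ζ ω)]
    · simp [Set.indicator]
    · intro u _ hu
      simp [Set.indicator, hu.symm]
    · simp
  have hsimple : ∀ u, IsSimple mΩ (fun ω => {ω | ζ ω = u}.indicator (fun _ => (1 : ℝ)) ω) :=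
    fun u => (IsSimple.const mΩ (1 : ℝ)).indicator (hmeas u)
  rw [← integral_indicator (hm _ hA)]
  simp only [hdecomp]
  rw [integral_finsetSum _ fun u _ => IsSimple.integrable le_rfl
    ((hsimple u).comp₂ (((hΦ u).indicator hA).mono hm) fun a b => a * b)]
  refine Finset.sum_congr rfl fun u _ => ?_
  have hI : IndepFun ({ω | ζ ω = u}.indicator fun _ => (1 : ℝ)) (A.indicator (Φ u)) P := by
    rw [IndepFun_iff_Indep]
    refine indep_of_indep_of_le_left (indep_of_indep_of_le_right hind ?_) ?_
    · exact ((hΦ u).indicator hA).stronglyMeasurable.measurable.comap_le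
    · refine Measurable.comap_le ?_
      exact measurable_const.indicator ⟨{u}, measurableSet_singleton u, rfl⟩
  rw [hI.integral_fun_mul_eq_mul_integral
    (hsimple u).stronglyMeasurable.aestronglyMeasurable
    (((hΦ u).indicator hA).mono hm).stronglyMeasurable.aestronglyMeasurable,
    integral_indicator (hm _ hA), integral_indicator_const _ (hmeas u),
    smul_eq_mul, mul_one]

end Simple

/-! ### The information structure of the run -/

section Run

variable {d r n b K : ℕ} {Ω : Type*}

/-- The σ-algebras generated by the individual random choices. -/
@[reducible] def choiceAlgebra (ξ : ℕ → ℕ → Ω → Fin b → Fin n) (idx : ℕ → Ω → Fin (K + 1)) :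
    (ℕ × Fin K) ⊕ ℕ → MeasurableSpace Ω :=
  Sum.elim (fun q : ℕ × Fin K => MeasurableSpace.comap (ξ q.1 q.2) inferInstance)
    (fun s : ℕ => MeasurableSpace.comap (idx s) inferInstance)

/-- The choices made before the mini-batch `k` of epoch `s` is drawn. -/
def choicesBefore (K s k : ℕ) : Set ((ℕ × Fin K) ⊕ ℕ) :=
  {i | Sum.elim (fun q : ℕ × Fin K => q.1 < s ∨ q.1 = s ∧ (q.2 : ℕ) < k) (fun s' => s' < s) i}

/-- The information available before the mini-batch `k` of epoch `s` is drawn. -/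
@[reducible] def infoBefore (ξ : ℕ → ℕ → Ω → Fin b → Fin n) (idx : ℕ → Ω → Fin (K + 1)) (s k : ℕ) :
    MeasurableSpace Ω :=
  ⨆ i ∈ choicesBefore K s k, choiceAlgebra ξ idx i

variable {ξ : ℕ → ℕ → Ω → Fin b → Fin n} {idx : ℕ → Ω → Fin (K + 1)}

lemma infoBefore_mono {s k s' k' : ℕ} (h : s < s' ∨ s = s' ∧ k ≤ k') :
    infoBefore ξ idx s k ≤ infoBefore ξ idx s' k' := by
  refine biSup_mono ?_
  rintro (⟨t, j⟩ | t) hi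
  · simp only [choicesBefore, Set.mem_ofPred_eq, Sum.elim_inl] at hi ⊢
    omega
  · simp only [choicesBefore, Set.mem_ofPred_eq, Sum.elim_inr] at hi ⊢
    omega

lemma past_eq_infoBefore (s : ℕ) : past ξ idx s = infoBefore ξ idx s 0 := by
  refine le_antisymm ?_ ?_
  · refine iSup₂_le fun t ht => sup_le (iSup_le fun k => ?_) ?_
    · exact le_biSup (choiceAlgebra ξ idx) (i := Sum.inl (t, k)) (Or.inl ht)
    · exact le_biSup (choiceAlgebra ξ idx) (i := Sum.inr t) ht
  · refine iSup₂_le ?_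
    rintro (⟨t, j⟩ | t) hi
    · have ht : t < s := by
        simp only [choicesBefore, Set.mem_ofPred_eq, Sum.elim_inl] at hi
        omega
      refine le_trans ?_ (le_iSup₂ (f := fun (s' : ℕ) (_ : s' < s) =>
        (⨆ k : Fin K, MeasurableSpace.comap (ξ s' k) inferInstance) ⊔
          MeasurableSpace.comap (idx s') inferInstance) t ht)
      exact le_sup_of_le_left (le_iSup (fun k : Fin K =>
        MeasurableSpace.comap (ξ t k) inferInstance) j)
    · have ht : t < s := hi
      refine le_trans ?_ (le_iSup₂ (f := fun (s' : ℕ) (_ : s' < s) =>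
        (⨆ k : Fin K, MeasurableSpace.comap (ξ s' k) inferInstance) ⊔
          MeasurableSpace.comap (idx s') inferInstance) t ht)
      exact le_sup_right

lemma isSimple_batch {s k : ℕ} (hk : k < K) : IsSimple (infoBefore ξ idx s (k + 1)) (ξ s k) :=
  IsSimple.of_comap_le
    (le_biSup (choiceAlgebra ξ idx) (i := Sum.inl (s, ⟨k, hk⟩)) (Or.inr ⟨rfl, Nat.lt_succ_self k⟩))

lemma isSimple_idx (s : ℕ) : IsSimple (infoBefore ξ idx (s + 1) 0) (idx s) :=
  IsSimple.of_comap_le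
    (le_biSup (choiceAlgebra ξ idx) (i := Sum.inr s) (Nat.lt_succ_self s))

section Iterates

variable (R : Mat d r → Mat d r → Mat d r) (ρ τ : ℝ) (f : Fin n → Mat d r → ℝ) (X₀₀ : Mat d r)

/-- The iterate `X^{s,k}` as a random variable. -/
noncomputable abbrev runIter (ξ : ℕ → ℕ → Ω → Fin b → Fin n) (idx : ℕ → Ω → Fin (K + 1))
    (s k : ℕ) (ω : Ω) : Mat d r :=
  iter R ρ τ f X₀₀ (fun s k => ξ s k ω) (fun s => idx s ω) s k

/-- One step of the algorithm from `X` with reference point `X₀` and mini-batch `u`. -/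
noncomputable abbrev svrgStep (X₀ X : Mat d r) (u : Fin b → Fin n) : Mat d r :=
  R X (-(τ • dirOp ρ X (svrgGrad f X₀ u X)))

/-- Finitely many random choices produce finitely many iterates. Thus every function of the iterates
is measurable and integrable, with no measurability required of `R`, `f` or the gradients. -/
lemma isSimple_runIter (s : ℕ) {k : ℕ} (hk : k ≤ K) :
    IsSimple (infoBefore ξ idx s k) (runIter R ρ τ f X₀₀ ξ idx s k) := by
  have hinner : ∀ s, IsSimple (infoBefore ξ idx s 0) (runIter R ρ τ f X₀₀ ξ idx s 0) →
      ∀ k ≤ K, IsSimple (infoBefore ξ idx s k) (runIter R ρ τ f X₀₀ ξ idx s k) := by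
    intro s h0 k
    induction k with
    | zero => exact fun _ => h0
    | succ k ih =>
      intro hk
      have h0' := h0.mono (infoBefore_mono (s' := s) (k' := k + 1) (Or.inr ⟨rfl, Nat.zero_le _⟩))
      have h1 := (ih (by omega)).mono
        (infoBefore_mono (s' := s) (k' := k + 1) (Or.inr ⟨rfl, Nat.le_succ k⟩))
      exact (h0'.comp₂ h1 Prod.mk).comp₂ (isSimple_batch (by omega))
        fun p u => svrgStep R ρ τ f p.1 p.2 u
  refine hinner s ?_ k hk
  induction s with
  | zero => exact IsSimple.const _ X₀₀
  | succ s ih =>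
    refine IsSimple.select (Y := fun j : Fin (K + 1) => runIter R ρ τ f X₀₀ ξ idx s j)
      (isSimple_idx s) fun j => ?_
    exact (hinner s (ih) j (by omega)).mono (infoBefore_mono (Or.inl (Nat.lt_succ_self s)))

lemma runIter_mem_stiefel (hR : IsRetraction R) (hX₀₀ : X₀₀ ∈ Stiefel d r) (s k : ℕ) (ω : Ω) :
    runIter R ρ τ f X₀₀ ξ idx s k ω ∈ Stiefel d r := by
  have hinner : ∀ s, runIter R ρ τ f X₀₀ ξ idx s 0 ω ∈ Stiefel d r →
      ∀ k, runIter R ρ τ f X₀₀ ξ idx s k ω ∈ Stiefel d r := by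
    intro s h0 k
    induction k with
    | zero => exact h0
    | succ k ih => exact step_mem_stiefel hR ih _
  refine hinner s ?_ k
  induction s with
  | zero => exact hX₀₀
  | succ s ih => exact hinner s ih (idx s ω)

end Iterates

variable [mΩ : MeasurableSpace Ω] {P : Measure Ω} [IsProbabilityMeasure P] {p : Fin (K + 1) → ℝ}

omit [IsProbabilityMeasure P] in
lemma choiceAlgebra_le (hrun : IsSampling P p ξ idx) (i : (ℕ × Fin K) ⊕ ℕ) :
    choiceAlgebra ξ idx i ≤ mΩ := by
  rcases i with ⟨s, k⟩ | s
  · exact (hrun.measurable_batch s k k.2).comap_le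
  · exact (hrun.measurable_idx s).comap_le

omit [IsProbabilityMeasure P] in
lemma infoBefore_le (hrun : IsSampling P p ξ idx) (s k : ℕ) : infoBefore ξ idx s k ≤ mΩ :=
  iSup₂_le fun i _ => choiceAlgebra_le hrun i

-- σ-algebras generated by disjoint subfamilies of the independent choices are independent. The
-- index of an epoch is absent from `choicesBefore` throughout that epoch, so it too is independent
-- of all its mini-batches.
omit [IsProbabilityMeasure P] in
lemma indep_choice_infoBefore (hrun : IsSampling P p ξ idx) {s k : ℕ} {i : (ℕ × Fin K) ⊕ ℕ}
    (hi : i ∉ choicesBefore K s k) : Indep (choiceAlgebra ξ idx i) (infoBefore ξ idx s k) P := by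
  have h := indep_iSup_of_disjoint (choiceAlgebra_le hrun) hrun.indep
    (S := {i}) (T := choicesBefore K s k) (Set.disjoint_singleton_left.2 hi)
  rwa [iSup_singleton] at h

lemma setIntegral_batch (hrun : IsSampling P p ξ idx) (s : ℕ) {k : ℕ} (hk : k < K)
    {Φ : (Fin b → Fin n) → Ω → ℝ} (hΦ : ∀ u, IsSimple (infoBefore ξ idx s k) (Φ u))
    {A : Set Ω} (hA : MeasurableSet[infoBefore ξ idx s k] A) :
    ∫ ω in A, Φ (ξ s k ω) ω ∂P = ∫ ω in A, batchAvg (fun u => Φ u ω) ∂P := by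
  have hi : (Sum.inl (s, ⟨k, hk⟩) : (ℕ × Fin K) ⊕ ℕ) ∉ choicesBefore K s k := by
    simp [choicesBefore]
  rw [setIntegral_select_of_indep (hrun.measurable_batch s k hk) (infoBefore_le hrun s k)
    (indep_choice_infoBefore hrun hi) hΦ hA]
  unfold batchAvg
  rw [integral_finsetSum _ fun u _ =>
    (((hΦ u).integrable (infoBefore_le hrun s k)).const_mul _)]
  exact Finset.sum_congr rfl fun u _ => by rw [hrun.law_batch s k hk, integral_const_mul]

lemma setIntegral_idx (hrun : IsSampling P p ξ idx) (s : ℕ)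
    {Φ : Fin (K + 1) → Ω → ℝ} (hΦ : ∀ u, IsSimple (infoBefore ξ idx s K) (Φ u))
    {A : Set Ω} (hA : MeasurableSet[infoBefore ξ idx s K] A) :
    ∫ ω in A, Φ (idx s ω) ω ∂P = ∑ k, p k * ∫ ω in A, Φ k ω ∂P := by
  have hi : (Sum.inr s : (ℕ × Fin K) ⊕ ℕ) ∉ choicesBefore K s K := by
    simp [choicesBefore]
  rw [setIntegral_select_of_indep (hrun.measurable_idx s) (infoBefore_le hrun s K)
    (indep_choice_infoBefore hrun hi) hΦ hA]
  simp only [hrun.law_idx]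

end Run

/-! ### Contraction over one epoch -/

/-- The mean of `I` under the output law, bounded by its initial value, given the decrease of `I`
over an epoch and the Łojasiewicz inequality. -/
lemma outputLaw_mean_le {K : ℕ} {α : ℝ} (hα : 0 < α) {Δ I G : ℕ → ℝ} (hΔ : ∀ k, 0 ≤ Δ k)
    (hG : ∀ k, 0 ≤ G k)
    (hdec : ∀ k ≤ K, I k + ∑ j ∈ Finset.range k, Δ j * G j ≤ I 0)
    (hup : ∀ k ≤ K, I k ≤ α ^ 2 * G k) (hlow : ∀ k ≤ K, -I k ≤ α ^ 2 * G k) :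
    (∑ k : Fin (K + 1), outputLaw α K Δ k * I k ≤
        α ^ 2 / (α ^ 2 + ∑ j ∈ Finset.range K, Δ j) * I 0) ∧
      ∑ k : Fin (K + 1), outputLaw α K Δ k * I k ≤
        (1 + (∑ j ∈ Finset.range K, Δ j) / (α ^ 2 + ∑ j ∈ Finset.range K, Δ j)) * I 0 := by
  set S := ∑ j ∈ Finset.range K, Δ j with hS
  have hS0 : 0 ≤ S := Finset.sum_nonneg fun j _ => hΔ j
  have hα2 : 0 < α ^ 2 := by positivity
  have hpos : 0 < α ^ 2 + S := by linarith
  have hmean : ∑ k : Fin (K + 1), outputLaw α K Δ k * I k =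
      (∑ j ∈ Finset.range K, Δ j * I j + α ^ 2 * I K) / (α ^ 2 + S) := by
    unfold outputLaw
    rw [← hS, Fin.sum_univ_eq_sum_range (fun k => (if k < K then Δ k else α ^ 2) / (α ^ 2 + S) * I k),
      Finset.sum_range_succ, add_div, Finset.sum_div]
    congr 1
    · refine Finset.sum_congr rfl fun j hj => ?_
      rw [if_pos (Finset.mem_range.1 hj)]; ring
    · rw [if_neg (lt_irrefl K)]; ring
  have hK := hdec K le_rfl
  have h1 : ∑ j ∈ Finset.range K, Δ j * I j ≤ α ^ 2 * ∑ j ∈ Finset.range K, Δ j * G j := by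
    rw [Finset.mul_sum]
    refine Finset.sum_le_sum fun j hj => ?_
    have := mul_le_mul_of_nonneg_left (hup j (Finset.mem_range.1 hj).le) (hΔ j)
    linarith
  have h2 : -∑ j ∈ Finset.range K, Δ j * I j ≤ α ^ 2 * ∑ j ∈ Finset.range K, Δ j * G j := by
    rw [Finset.mul_sum, ← Finset.sum_neg_distrib]
    refine Finset.sum_le_sum fun j hj => ?_
    have := mul_le_mul_of_nonneg_left (hlow j (Finset.mem_range.1 hj).le) (hΔ j)
    linarith
  have h3 : ∑ j ∈ Finset.range K, Δ j * I j ≤ S * I 0 := by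
    rw [hS, Finset.sum_mul]
    refine Finset.sum_le_sum fun j hj => mul_le_mul_of_nonneg_left ?_ (hΔ j)
    have := hdec j (Finset.mem_range.1 hj).le
    have := Finset.sum_nonneg fun i (_ : i ∈ Finset.range j) => mul_nonneg (hΔ i) (hG i)
    linarith
  -- With `h1` this gives the contraction. With `h2` it gives `α² I K ≤ α² I 0 + ∑ Δ_j I_j`, and
  -- `h3` then bounds the numerator by `(α² + 2S) I 0`.
  have h4 := mul_le_mul_of_nonneg_left hK hα2.le
  rw [hmean]
  constructor
  · rw [div_mul_eq_mul_div]
    gcongr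
    linarith
  · rw [show (1 + S / (α ^ 2 + S)) * I 0 = (α ^ 2 * I 0 + S * I 0 + S * I 0) / (α ^ 2 + S) by
      field_simp]
    refine div_le_div_of_nonneg_right ?_ hpos.le
    linarith

section Epoch

variable {d r n b K : ℕ} {Ω : Type*} [mΩ : MeasurableSpace Ω] {P : Measure Ω}
  [IsProbabilityMeasure P] {ξ : ℕ → ℕ → Ω → Fin b → Fin n} {idx : ℕ → Ω → Fin (K + 1)}
  {R : Mat d r → Mat d r → Mat d r} {f : Fin n → Mat d r → ℝ} {X₀₀ Xbar : Mat d r}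
  {Lh Lt L v β τ ρ α : ℝ}

/-- The integrals of the suboptimality of the output of an epoch, over an event that is known at
the start of the epoch. -/
lemma setIntegral_output_le (hn : 1 ≤ n) (hLh : 0 < Lh) (hLt : 0 < Lt) (hβ : 0 < β) (hτ : 0 < τ) (hα : 0 < α)
    (hΔ : ∀ k, 0 ≤ Del Lh Lt L v β τ b K k)
    (hR : IsRetraction R) (hX₀₀ : X₀₀ ∈ Stiefel d r)
    (hobj : ∀ X₀ ∈ Stiefel d r, ∀ X ∈ Stiefel d r,
      batchAvg (fun u : Fin b → Fin n => objective f (svrgStep R ρ τ f X₀ X u)) ≤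
        objective f X - τ * (v - Lh * τ / 2) * ‖riemGrad ρ (objective f) X‖ ^ 2 +
          Lh / 2 * τ ^ 2 * (L ^ 2 / (v ^ 2 * b)) * ‖X - X₀‖ ^ 2)
    (hdist : ∀ X₀ ∈ Stiefel d r, ∀ X ∈ Stiefel d r,
      batchAvg (fun u : Fin b → Fin n => ‖svrgStep R ρ τ f X₀ X u - X₀‖ ^ 2) ≤
        (1 + growth Lt L v β τ b) * ‖X - X₀‖ ^ 2 +
          (Lt * τ ^ 2 + 2 * τ / β) * ‖riemGrad ρ (objective f) X‖ ^ 2)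
    (hrun : IsSampling P (outputLaw α K (Del Lh Lt L v β τ b K)) ξ idx)
    (hLoj : ∀ᵐ ω ∂P, ∀ s, ∀ k ≤ K,
      |objective f (runIter R ρ τ f X₀₀ ξ idx s k ω) - objective f Xbar| ≤
        α ^ 2 * ‖riemGrad ρ (objective f) (runIter R ρ τ f X₀₀ ξ idx s k ω)‖ ^ 2)
    (s : ℕ) {A : Set Ω} (hA : MeasurableSet[infoBefore ξ idx s 0] A) :
    (∫ ω in A, (objective f (runIter R ρ τ f X₀₀ ξ idx (s + 1) 0 ω) - objective f Xbar) ∂P ≤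
      α ^ 2 / (α ^ 2 + ∑ j ∈ Finset.range K, Del Lh Lt L v β τ b K j) *
        ∫ ω in A, (objective f (runIter R ρ τ f X₀₀ ξ idx s 0 ω) - objective f Xbar) ∂P) ∧
    ∫ ω in A, (objective f (runIter R ρ τ f X₀₀ ξ idx (s + 1) 0 ω) - objective f Xbar) ∂P ≤
      (1 + (∑ j ∈ Finset.range K, Del Lh Lt L v β τ b K j) /
          (α ^ 2 + ∑ j ∈ Finset.range K, Del Lh Lt L v β τ b K j)) *
        ∫ ω in A, (objective f (runIter R ρ τ f X₀₀ ξ idx s 0 ω) - objective f Xbar) ∂P := by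
  set X : ℕ → Ω → Mat d r := runIter R ρ τ f X₀₀ ξ idx s with hX
  set gap : Mat d r → ℝ := fun Y => objective f Y - objective f Xbar with hgap
  set g : Mat d r → ℝ := fun Y => ‖riemGrad ρ (objective f) Y‖ ^ 2 with hg
  have hXs : ∀ k ω, X k ω ∈ Stiefel d r := runIter_mem_stiefel R ρ τ f X₀₀ hR hX₀₀ s
  have hXsimple : ∀ k ≤ K, IsSimple (infoBefore ξ idx s k) (X k) := fun k hk =>
    isSimple_runIter R ρ τ f X₀₀ s hk
  have hX0simple : ∀ k, IsSimple (infoBefore ξ idx s k) (X 0) := fun k =>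
    (hXsimple 0 (Nat.zero_le _)).mono (infoBefore_mono (Or.inr ⟨rfl, Nat.zero_le _⟩))
  have hAk : ∀ k, MeasurableSet[infoBefore ξ idx s k] A := fun k =>
    infoBefore_mono (Or.inr ⟨rfl, Nat.zero_le _⟩) _ hA
  have hint : ∀ k ≤ K, ∀ φ : Mat d r → Mat d r → ℝ,
      IntegrableOn (fun ω => φ (X 0 ω) (X k ω)) A P := fun k hk φ =>
    (((hX0simple k).comp₂ (hXsimple k hk) φ).integrable (infoBefore_le hrun s k)).integrableOn
  -- One-step bounds pass to integrals: the fresh mini-batch is independent of the current iterate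
  -- and of `A`, so it can be averaged out first.
  have hstep : ∀ k < K, ∀ φ ψ : Mat d r → Mat d r → ℝ,
      (∀ Y₀ ∈ Stiefel d r, ∀ Y ∈ Stiefel d r,
        batchAvg (fun u : Fin b → Fin n => φ Y₀ (svrgStep R ρ τ f Y₀ Y u)) ≤ ψ Y₀ Y) →
      ∫ ω in A, φ (X 0 ω) (X (k + 1) ω) ∂P ≤ ∫ ω in A, ψ (X 0 ω) (X k ω) ∂P := by
    intro k hk φ ψ h
    have h1 := setIntegral_batch hrun s hk
      (Φ := fun u ω => φ (X 0 ω) (svrgStep R ρ τ f (X 0 ω) (X k ω) u))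
      (fun u => (hX0simple k).comp₂ (hXsimple k hk.le)
        fun Y₀ Y => φ Y₀ (svrgStep R ρ τ f Y₀ Y u)) (hAk k)
    refine h1.trans_le ?_
    exact integral_mono (hint k hk.le fun Y₀ Y =>
        batchAvg fun u : Fin b → Fin n => φ Y₀ (svrgStep R ρ τ f Y₀ Y u))
      (hint k hk.le ψ) fun ω => h _ (hXs 0 ω) _ (hXs k ω)
  have hdec : ∀ k ≤ K, ∫ ω in A, gap (X k ω) ∂P +
      ∑ j ∈ Finset.range k, Del Lh Lt L v β τ b K j * ∫ ω in A, g (X j ω) ∂P ≤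
        ∫ ω in A, gap (X 0 ω) ∂P := by
    intro k hk
    refine epoch_decrease (F := fun k => ∫ ω in A, gap (X k ω) ∂P)
      (E := fun k => ∫ ω in A, ‖X k ω - X 0 ω‖ ^ 2 ∂P)
      (G := fun k => ∫ ω in A, g (X k ω) ∂P) hLh hLt hβ hτ (by simp) ?_ ?_
      (fun k => integral_nonneg fun ω => by positivity) hk
    · intro k hk
      have h := hstep k hk (fun _ Y => gap Y)
        (fun Y₀ Y => gap Y - τ * (v - Lh * τ / 2) * g Y +
          Lh / 2 * τ ^ 2 * (L ^ 2 / (v ^ 2 * b)) * ‖Y - Y₀‖ ^ 2) ?_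
      · rwa [integral_add (hint k hk.le fun Y₀ Y => gap Y - τ * (v - Lh * τ / 2) * g Y)
            (hint k hk.le fun Y₀ Y => Lh / 2 * τ ^ 2 * (L ^ 2 / (v ^ 2 * b)) * ‖Y - Y₀‖ ^ 2),
          integral_sub (hint k hk.le fun Y₀ Y => gap Y)
            (hint k hk.le fun Y₀ Y => τ * (v - Lh * τ / 2) * g Y),
          integral_const_mul, integral_const_mul] at h
      · intro Y₀ hY₀ Y hY
        have h1 := hobj Y₀ hY₀ Y hY
        have h2 : batchAvg (fun u : Fin b → Fin n => gap (svrgStep R ρ τ f Y₀ Y u)) =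
            batchAvg (fun u : Fin b → Fin n => objective f (svrgStep R ρ τ f Y₀ Y u)) +
              -objective f Xbar := by
          simp only [hgap, sub_eq_add_neg]
          rw [batchAvg_add, batchAvg_const hn]
        rw [h2]
        simp only [hgap, hg]
        linarith
    · intro k hk
      have h := hstep k hk (fun Y₀ Y => ‖Y - Y₀‖ ^ 2)
        (fun Y₀ Y => (1 + growth Lt L v β τ b) * ‖Y - Y₀‖ ^ 2 +
          (Lt * τ ^ 2 + 2 * τ / β) * g Y) hdist
      rwa [integral_add (hint k hk.le fun Y₀ Y => (1 + growth Lt L v β τ b) * ‖Y - Y₀‖ ^ 2)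
            (hint k hk.le fun Y₀ Y => (Lt * τ ^ 2 + 2 * τ / β) * g Y),
          integral_const_mul, integral_const_mul] at h
  have hLojA : ∀ᵐ ω ∂P.restrict A, ∀ k ≤ K, |gap (X k ω)| ≤ α ^ 2 * g (X k ω) :=
    ae_restrict_of_ae (hLoj.mono fun ω h => h s)
  have hup : ∀ k ≤ K, ∫ ω in A, gap (X k ω) ∂P ≤ α ^ 2 * ∫ ω in A, g (X k ω) ∂P := by
    intro k hk
    rw [← integral_const_mul]
    refine integral_mono_ae (hint k hk fun _ Y => gap Y) (hint k hk fun _ Y => α ^ 2 * g Y) ?_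
    filter_upwards [hLojA] with ω h using (le_abs_self _).trans (h k hk)
  have hlow : ∀ k ≤ K, -∫ ω in A, gap (X k ω) ∂P ≤ α ^ 2 * ∫ ω in A, g (X k ω) ∂P := by
    intro k hk
    rw [← integral_const_mul, ← integral_neg]
    refine integral_mono_ae (hint k hk fun _ Y => -gap Y) (hint k hk fun _ Y => α ^ 2 * g Y) ?_
    filter_upwards [hLojA] with ω h using (neg_le_abs _).trans (h k hk)
  have hout : ∫ ω in A, gap (runIter R ρ τ f X₀₀ ξ idx (s + 1) 0 ω) ∂P =
      ∑ k : Fin (K + 1), outputLaw α K (Del Lh Lt L v β τ b K) k * ∫ ω in A, gap (X k ω) ∂P :=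
    setIntegral_idx hrun s (Φ := fun k ω => gap (X k ω))
      (fun k => ((hXsimple k (by omega)).mono
        (infoBefore_mono (Or.inr ⟨rfl, by omega⟩))).comp gap) (hAk K)
  have := outputLaw_mean_le (I := fun k => ∫ ω in A, gap (X k ω) ∂P)
    (G := fun k => ∫ ω in A, g (X k ω) ∂P) hα hΔ
    (fun k => integral_nonneg fun ω => by positivity) hdec hup hlow
  rw [← hout] at this
  exact this

end Epoch

/-- Geometric growth of a bounded sequence forces its initial value to be nonnegative. -/
lemma nonneg_of_geometric_of_bddBelow {x : ℕ → ℝ} {a M : ℝ} (ha : 1 < a)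
    (hx : ∀ m, x (m + 1) ≤ a * x m) (hM : ∀ m, -M ≤ x m) : 0 ≤ x 0 := by
  by_contra! h
  have hpow : ∀ m, x m ≤ a ^ m * x 0 := by
    intro m
    induction m with
    | zero => simp
    | succ m ih =>
      calc x (m + 1) ≤ a * x m := hx m
        _ ≤ a * (a ^ m * x 0) := by gcongr
        _ = _ := by ring
  obtain ⟨m, hm⟩ := pow_unbounded_of_one_lt (M / -x 0) ha
  rw [div_lt_iff₀ (by linarith)] at hm
  have := hpow m
  have := hM m
  linarith

end SSVRG

/-! ### Assembly of the main theorem -/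

open SSVRG in
theorem mainTheorem2
    {d r n : ℕ} (hn : 1 ≤ n)
    -- the problem: component functions, their Lipschitz constant and a gradient bound
    (f : Fin n → SSVRG.Mat d r → ℝ) (L C : ℝ) (hL : 0 < L)
    (hdiff : ∀ i, ∀ X ∈ SSVRG.Stiefel d r, DifferentiableAt ℝ (f i) X)
    (hlip : ∀ i, ∀ X ∈ SSVRG.Stiefel d r, ∀ Y ∈ SSVRG.Stiefel d r,
      ‖SSVRG.euclGrad (f i) X - SSVRG.euclGrad (f i) Y‖ ≤ L * ‖X - Y‖)
    (hdiff_hull : ∀ X ∈ convexHull ℝ (SSVRG.Stiefel d r),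
      DifferentiableAt ℝ (SSVRG.objective f) X)
    (hlip_hull : ∀ X ∈ convexHull ℝ (SSVRG.Stiefel d r), ∀ Y ∈ convexHull ℝ (SSVRG.Stiefel d r),
      ‖SSVRG.euclGrad (SSVRG.objective f) X - SSVRG.euclGrad (SSVRG.objective f) Y‖ ≤ L * ‖X - Y‖)
    (hC : 0 < C) (hbound : ∀ X ∈ SSVRG.Stiefel d r, ‖SSVRG.euclGrad (SSVRG.objective f) X‖ ≤ C)
    -- the retraction with its constants, and the direction parameter
    (R : SSVRG.Mat d r → SSVRG.Mat d r → SSVRG.Mat d r) (hR : SSVRG.IsRetraction R)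
    (L₁ L₂ : ℝ) (hR' : SSVRG.RetractionConstants R L₁ L₂)
    (ρ : ℝ) (hρ : 0 ≤ ρ)
    -- the parameters
    (μ κ c : ℝ) (hμ₀ : 0 ≤ μ) (hμ₁ : μ ≤ 2 / 3) (hκ : 0 < κ) (hc₀ : 0 < c) (hc₁ : c < 1)
    (hc : SSVRG.hatL L L₁ L₂ C / (√(SSVRG.tildeL L₁ L₂ r) * L) * Real.exp (c ^ 2 + 2 * c) * c ≤ 1)
    (K b : ℕ) (β τ : ℝ)
    (hK : K = ⌈(κ * n) ^ (1 / (3 * (1 - μ)))⌉₊)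
    (hb : b = ⌈(K : ℝ) ^ (2 - 3 * μ)⌉₊)
    (hβ : β = √(SSVRG.tildeL L₁ L₂ r) * L / SSVRG.nu ρ * (K : ℝ) ^ (μ - 1))
    (hτ : τ = c * SSVRG.nu ρ / (√(SSVRG.tildeL L₁ L₂ r) * L) * (K : ℝ) ^ (-μ))
    -- a stationary point at which the Łojasiewicz inequality holds
    (Xbar : SSVRG.Mat d r) (hXbar : Xbar ∈ SSVRG.Stiefel d r)
    (hstat : SSVRG.riemGrad ρ (SSVRG.objective f) Xbar = 0)
    (δ α : ℝ) (hδ : 0 < δ) (hα : 0 < α)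
    (hLoj : ∀ X ∈ SSVRG.Stiefel d r, ‖X - Xbar‖ ≤ δ →
      √|SSVRG.objective f X - SSVRG.objective f Xbar|
        ≤ α * ‖SSVRG.riemGrad ρ (SSVRG.objective f) X‖)
    -- the random run of the algorithm
    {Ω : Type*} [MeasurableSpace Ω] (P : Measure Ω) [IsProbabilityMeasure P]
    (ξ : ℕ → ℕ → Ω → Fin b → Fin n) (idx : ℕ → Ω → Fin (K + 1))
    (hrun : SSVRG.IsSampling P
      (SSVRG.outputLaw α K
        (SSVRG.Del (SSVRG.hatL L L₁ L₂ C) (SSVRG.tildeL L₁ L₂ r) L (SSVRG.nu ρ) β τ b K)) ξ idx)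
    (X₀₀ : SSVRG.Mat d r) (hX₀₀ : X₀₀ ∈ SSVRG.Stiefel d r)
    (hball : ∀ᵐ ω ∂P, ∀ s, ∀ k ≤ K,
      ‖SSVRG.iter R ρ τ f X₀₀ (fun s k => ξ s k ω) (fun s => idx s ω) s k - Xbar‖ ≤ δ) :
    (∀ s : ℕ,
      P[fun ω => SSVRG.objective f
            (SSVRG.epochOutput R ρ τ f X₀₀ (fun s k => ξ s k ω) (fun s => idx s ω) s)
          - SSVRG.objective f Xbar | SSVRG.past ξ idx s]
        ≤ᵐ[P] fun ω => SSVRG.rate (SSVRG.tildeL L₁ L₂ r) L α c (SSVRG.nu ρ) κ n *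
          (SSVRG.objective f
              (SSVRG.epochStart R ρ τ f X₀₀ (fun s k => ξ s k ω) (fun s => idx s ω) s)
            - SSVRG.objective f Xbar)) ∧
    (∀ s : ℕ,
      ∫ ω, (SSVRG.objective f
            (SSVRG.epochOutput R ρ τ f X₀₀ (fun s k => ξ s k ω) (fun s => idx s ω) s)
          - SSVRG.objective f Xbar) ∂P
        ≤ SSVRG.rate (SSVRG.tildeL L₁ L₂ r) L α c (SSVRG.nu ρ) κ n ^ (s + 1) *
          (SSVRG.objective f X₀₀ - SSVRG.objective f Xbar)) := by
  have hν := nu_pos hρ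
  have hK1 := epoch_length_pos hn hκ hK
  have hb1 := batch_size_pos hK1 hb
  have hLt := one_le_tildeL hR' r
  have hLh := hatL_pos hR' hL hC
  have hs : 0 < √(tildeL L₁ L₂ r) := Real.sqrt_pos.2 (by linarith)
  have hK0 : (0 : ℝ) < K := by positivity
  have hβ0 : 0 < β := by rw [hβ]; positivity
  have hτ0 : 0 < τ := by rw [hτ]; positivity
  have hΔ0 : ∀ k, 0 < Del (hatL L L₁ L₂ C) (tildeL L₁ L₂ r) L (nu ρ) β τ b K k := fun k =>
    lt_of_lt_of_le (by positivity) (half_le_Del hLh hLt hL hν hμ₀ hμ₁ hc₀ hc hK1 hb hβ hτ k)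
  have hS := rate_weight_le_sum_Del hn hκ hLh hLt hL hν hμ₀ hμ₁ hc₀ hc hK hb hβ hτ
  have hq := div_le_rate hα hLt hL hκ hc₀ hS
  have hq0 : 0 ≤ rate (tildeL L₁ L₂ r) L α c (nu ρ) κ n := rate_nonneg hL hκ hc₀
  have hLoj' : ∀ᵐ ω ∂P, ∀ s, ∀ k ≤ K,
      |objective f (runIter R ρ τ f X₀₀ ξ idx s k ω) - objective f Xbar| ≤
        α ^ 2 * ‖riemGrad ρ (objective f) (runIter R ρ τ f X₀₀ ξ idx s k ω)‖ ^ 2 := by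
    filter_upwards [hball] with ω h s k hk
    have h1 := hLoj _ (runIter_mem_stiefel R ρ τ f X₀₀ hR hX₀₀ s k ω) (h s k hk)
    rw [← mul_pow]
    exact (Real.sqrt_le_left (by positivity)).1 h1
  have hepoch := fun s A hA => setIntegral_output_le (A := A) hn hLh (by linarith) hβ0 hτ0 hα
    (fun k => (hΔ0 k).le) hR hX₀₀
    (fun X₀ hX₀ X hX => batchAvg_objective_step_le hn hb1 hL hdiff hlip hdiff_hull hlip_hull hC
      hbound hR hR' hρ hτ0.le hX₀ hX)
    (fun X₀ hX₀ X hX => batchAvg_dist_step_le hn hb1 hdiff hlip hR' hρ hτ0 hβ0 hX₀ hX)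
    hrun hLoj' s hA
  set S := ∑ j ∈ Finset.range K, Del (hatL L L₁ L₂ C) (tildeL L₁ L₂ r) L (nu ρ) β τ b K j
  have hS0 : 0 < S := Finset.sum_pos (fun j _ => hΔ0 j) (Finset.nonempty_range_iff.2 (by omega))
  set q := rate (tildeL L₁ L₂ r) L α c (nu ρ) κ n
  set gap : ℕ → Ω → ℝ := fun s ω =>
    objective f (runIter R ρ τ f X₀₀ ξ idx s 0 ω) - objective f Xbar with hgap
  have hsimple : ∀ s, IsSimple (infoBefore ξ idx s 0) (gap s) := fun s =>
    (isSimple_runIter R ρ τ f X₀₀ s (Nat.zero_le _)).comp fun Y => objective f Y - objective f Xbar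
  have hle := infoBefore_le hrun
  have hgapint : ∀ s, Integrable (gap s) P := fun s => (hsimple s).integrable (hle s 0)
  -- Łojasiewicz together with `‖grad f‖ ≤ C/ν` bounds the gap below uniformly in the epoch.
  have hbdd : ∀ s, ∀ᵐ ω ∂P, -(α ^ 2 * (C ^ 2 / nu ρ ^ 2)) ≤ gap s ω := by
    intro s
    filter_upwards [hLoj'] with ω h
    have hmem := runIter_mem_stiefel R ρ τ f X₀₀ hR hX₀₀ (ξ := ξ) (idx := idx) s 0 ω
    have h1 := norm_dirOp_le hmem hρ (euclGrad (objective f) (runIter R ρ τ f X₀₀ ξ idx s 0 ω))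
    have h2 := pow_le_pow_left₀ (norm_nonneg _) (hbound _ hmem) 2
    have h3 : ‖riemGrad ρ (objective f) (runIter R ρ τ f X₀₀ ξ idx s 0 ω)‖ ^ 2 ≤
        C ^ 2 / nu ρ ^ 2 := by
      rw [le_div_iff₀ (by positivity), mul_comm]
      exact h1.trans h2
    exact neg_le_of_abs_le ((h s 0 (Nat.zero_le _)).trans (by gcongr))
  -- An event known at epoch `s` remains known later, so the expanding bound iterates on the same
  -- `A`; a negative integral would contradict `hbdd`.
  have hnonneg : ∀ s A, MeasurableSet[infoBefore ξ idx s 0] A → 0 ≤ ∫ ω in A, gap s ω ∂P := by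
    intro s A hA
    refine nonneg_of_geometric_of_bddBelow (x := fun m => ∫ ω in A, gap (s + m) ω ∂P)
      (a := 1 + S / (α ^ 2 + S)) (M := α ^ 2 * (C ^ 2 / nu ρ ^ 2)) ?_ ?_ ?_
    · have : 0 < S / (α ^ 2 + S) := by positivity
      linarith
    · intro m
      refine (hepoch (s + m) A (infoBefore_mono ?_ _ hA)).2
      omega
    · intro m
      have hM : 0 ≤ α ^ 2 * (C ^ 2 / nu ρ ^ 2) := by positivity
      calc -(α ^ 2 * (C ^ 2 / nu ρ ^ 2)) ≤ ∫ ω in A, -(α ^ 2 * (C ^ 2 / nu ρ ^ 2)) ∂P := by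
            rw [setIntegral_const, smul_eq_mul]
            nlinarith [measureReal_le_one (μ := P) (s := A)]
        _ ≤ _ := integral_mono_ae (integrable_const _) (hgapint _).integrableOn
            (ae_restrict_of_ae (hbdd _))
  have hcontr : ∀ s A, MeasurableSet[infoBefore ξ idx s 0] A →
      ∫ ω in A, gap (s + 1) ω ∂P ≤ q * ∫ ω in A, gap s ω ∂P := fun s A hA =>
    (hepoch s A hA).1.trans (mul_le_mul_of_nonneg_right hq (hnonneg s A hA))
  refine ⟨fun s => ?_, fun s => ?_⟩
  · have hm : past ξ idx s ≤ _ := (past_eq_infoBefore s).trans_le (hle s 0)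
    have hmeas : StronglyMeasurable[past ξ idx s] fun ω => q * gap s ω := by
      rw [past_eq_infoBefore]
      exact ((hsimple s).comp (q * ·)).stronglyMeasurable
    change P[gap (s + 1)|past ξ idx s] ≤ᵐ[P] fun ω => q * gap s ω
    -- Restricting the measure to the past σ-algebra means that the inequality need only be tested
    -- on past events, where `hcontr` applies.
    refine ae_le_of_ae_le_trim (hm := hm) ?_
    refine ae_le_of_forall_setIntegral_le
      (integrable_condExp.trim hm stronglyMeasurable_condExp)
      (((hgapint s).const_mul q).trim hm hmeas) fun A hA _ => ?_
    rw [← setIntegral_trim hm stronglyMeasurable_condExp hA, ← setIntegral_trim hm hmeas hA,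
      setIntegral_condExp hm (hgapint (s + 1)) hA, integral_const_mul]
    rw [past_eq_infoBefore] at hA
    exact hcontr s A hA
  · change ∫ ω, gap (s + 1) ω ∂P ≤ q ^ (s + 1) * _
    have hstep : ∀ s, ∫ ω, gap (s + 1) ω ∂P ≤ q * ∫ ω, gap s ω ∂P := fun s => by
      simpa using hcontr s Set.univ MeasurableSet.univ
    have hall : ∀ s, ∫ ω, gap s ω ∂P ≤ q ^ s * (objective f X₀₀ - objective f Xbar) := by
      intro s
      induction s with
      | zero =>
        have : gap 0 = fun _ => objective f X₀₀ - objective f Xbar := rfl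
        simp [this]
      | succ s ih =>
        calc ∫ ω, gap (s + 1) ω ∂P ≤ q * ∫ ω, gap s ω ∂P := hstep s
          _ ≤ q * (q ^ s * (objective f X₀₀ - objective f Xbar)) := by gcongr
          _ = _ := by ring
    exact hall (s + 1)
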